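/- Let $F$ be a field of characteristic $0$ and let $X_r\xrightarrow{f_r}X_{r-1}\to\cdots\xrightarrow{f_1}X_0$ be finite dominant $F$-morphisms of integral $F$-schemes (for instance, smooth projective irreducible varieties over $F$, or spectra of fields). Write $F(X_i)$ for the function fields, $d_i=[F(X_i):F(X_{i-1})]$ for the degree of $f_i$, $g_i:=f_1\circ\cdots\circ f_i:X_i\to X_0$ and $f:=g_r$. For a finite dominant map $h:X\to Y$ of integral $F$-schemes, the monodromy group $\mathrm{Mon}(h)$ is the image of the absolute Galois group of $F(Y)$ in the permutation group of the set of $F(Y)$-embeddings of $F(X)$ into an algebraic closure of $F(Y)$; that is, the Galois group of the Galois closure of $F(X)/F(Y)$. The map $h$ is indecomposable if $F(X)\neq F(Y)$ and there is no field strictly between $F(Y)$ and $F(X)$. Put $\Gamma_i:=\mathrm{Mon}(f_i)$, and let $\mathrm{soc}(\Gamma_i)$ be the subgroup generated by the minimal normal subgroups of $\Gamma_i$. Assume that: 1. every $f_i$ ($1\le i\le r$) is indecomposable and $\Gamma_i$ is a nonabelian almost simple group (that is, $L\le\Gamma_i\le\mathrm{Aut}(L)$ for a nonabelian simple group $L$);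 2. the Galois closures of $g_1,\dots,g_r$, viewed as subfields of a fixed algebraic closure of $F(X_0)$, are pairwise distinct; 3. for $2\le i\le r$, the kernel $K_i\le\Gamma_i^{d_{i-1}}$ of the projection $\mathrm{Mon}(f_{i-1}\circ f_i)\to\Gamma_{i-1}$ is nondiagonal, i.e. it is not the case that the projection of $K_i$ to each of the $d_{i-1}$ coordinates is injective. (The coordinates are the $F(X_{i-2})$-embeddings $y$ of $F(X_{i-1})$ into an algebraic closure of $F(X_{i-2})$, and the projection to the coordinate $y$ is the action of $K_i$ on the extensions of $y$ to $F(X_i)$.) Then: (a) $\mathrm{Mon}(f)$ contains the composition factors of the iterated wreath product $[\mathrm{soc}(\Gamma_i)]_{i=1}^r=\mathrm{soc}(\Gamma_r)\wr\cdots\wr\mathrm{soc}(\Gamma_1)$ of the permutation groups $\mathrm{soc}(\Gamma_i)$ of degree $d_i$: the multiset of Jordan–Hölder composition factors (up to isomorphism) of this group is contained, with multiplicities, in that of $\mathrm{Mon}(f)$. (b) $f=f_1\circ\cdots\circ f_r$ is, up to birational equivalence, the unique decomposition of $f$ into indecomposable maps: the chain of (images of the) function fields $F(X_0)\subset F(X_1)\subset\cdots\subset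 F(X_r)$ is the unique maximal chain of fields between $F(X_0)$ and $F(X_r)$. -/

import Mathlib

open CategoryTheory AlgebraicGeometry

universe u v

/-! ### Groups: socle, almost simple groups, composition factors -/

section Groups

/-- The socle of `G`: the subgroup generated by the minimal normal subgroups of `G`. -/
def socle (G : Type u) [Group G] : Subgroup G :=
  sSup {N : Subgroup G | Minimal (fun M : Subgroup G => M.Normal ∧ M ≠ ⊥) N}

/-- `G` is a nonabelian almost simple group, i.e. `L ≤ G ≤ Aut(L)` for some nonabelian simple
group `L`: it has a nonabelian simple normal subgroup whose centralizer in `G` is trivial. -/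
def IsNonabelianAlmostSimple (G : Type u) [Group G] : Prop :=
  ∃ L : Subgroup G, L.Normal ∧ IsSimpleGroup L ∧ (∃ x y : L, x * y ≠ y * x) ∧
    Subgroup.centralizer (L : Set G) = ⊥

/-- A composition series `1 = H₀ ⊲ H₁ ⊲ ⋯ ⊲ Hₙ = G` with simple successive quotients. -/
structure GroupCompositionSeries (G : Type u) [Group G] where
  length : ℕ
  term : Fin (length + 1) → Subgroup G
  term_zero : term 0 = ⊥
  term_last : term (Fin.last length) = ⊤
  le_succ : ∀ i : Fin length, term i.castSucc ≤ term i.succ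
  normal : ∀ i : Fin length, ((term i.castSucc).subgroupOf (term i.succ)).Normal
  simple : ∀ i : Fin length,
    IsSimpleGroup (term i.succ ⧸ (term i.castSucc).subgroupOf (term i.succ))

/-- The `i`-th factor of a composition series. -/
def GroupCompositionSeries.Factor {G : Type u} [Group G] (s : GroupCompositionSeries G)
    (i : Fin s.length) : Type u :=
  s.term i.succ ⧸ (s.term i.castSucc).subgroupOf (s.term i.succ)

instance {G : Type u} [Group G] (s : GroupCompositionSeries G) (i : Fin s.length) :
    Group (s.Factor i) :=
  haveI := s.normal i
  inferInstanceAs (Group (s.term i.succ ⧸ (s.term i.castSucc).subgroupOf (s.term i.succ)))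

/-- `G` contains the composition factors of `W`: the multiset of (isomorphism classes of)
composition factors of `W` is contained, with multiplicities, in that of `G`.
By the Jordan-Hölder theorem it does not matter which composition series are used. -/
def ContainsCompositionFactors (G : Type u) (W : Type v) [Group G] [Group W] : Prop :=
  ∃ (s : GroupCompositionSeries G) (t : GroupCompositionSeries W)
    (e : Fin t.length ↪ Fin s.length), ∀ i, Nonempty (t.Factor i ≃* s.Factor (e i))

end Groups

/-! ### Wreath products of permutation groups -/

section Wreath

/-- The wreath product `U ≀_J V` of permutation groups `U ≤ Sym(I)`, `V ≤ Sym(J)`, as a permutation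
group of `I × J`: an element permutes the branches `I × {j}` through an element of `V`, and the
branches are moved into each other by elements of `U`. -/
def wreathProduct {I J : Type u} (U : Subgroup (Equiv.Perm I)) (V : Subgroup (Equiv.Perm J)) :
    Subgroup (Equiv.Perm (I × J)) where
  carrier := {σ | ∃ v ∈ V, ∃ w : J → Equiv.Perm I, (∀ j, w j ∈ U) ∧
    ∀ i j, σ (i, j) = (w j i, v j)}
  one_mem' := ⟨1, V.one_mem, 1, fun _ => U.one_mem, fun _ _ => rfl⟩
  mul_mem' := by
    rintro σ τ ⟨v, hv, w, hw, h⟩ ⟨v', hv', w', hw', h'⟩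
    exact ⟨v * v', V.mul_mem hv hv', fun j => w (v' j) * w' j,
      fun j => U.mul_mem (hw _) (hw' _), fun i j => by simp [h, h']⟩
  inv_mem' := by
    rintro σ ⟨v, hv, w, hw, h⟩
    refine ⟨v⁻¹, V.inv_mem hv, fun j => (w (v⁻¹ j))⁻¹, fun j => U.inv_mem (hw _), fun i j => ?_⟩
    rw [Equiv.Perm.inv_eq_iff_eq, h]
    simp

/-- The set `I_r × (I_{r-1} × (⋯ × (I_1 × pt)))` on which an iterated wreath product acts
(the family is indexed from `0` to `r - 1`). -/
def IteratedProd : (r : ℕ) → (Fin r → Type u) → Type u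
  | 0, _ => PUnit
  | r + 1, I => I (Fin.last r) × IteratedProd r (fun i => I i.castSucc)

/-- The iterated wreath product `[U_i]_{i=1}^r = U_r ≀ ⋯ ≀ U_1` of permutation groups
`U_i ≤ Sym(I_i)` (the family is indexed from `0` to `r - 1`). -/
def iteratedWreathProduct : (r : ℕ) → (I : Fin r → Type u) →
    ((i : Fin r) → Subgroup (Equiv.Perm (I i))) → Subgroup (Equiv.Perm (IteratedProd r I))
  | 0, _, _ => ⊤
  | r + 1, _, U =>
      wreathProduct (U (Fin.last r)) (iteratedWreathProduct r _ (fun i => U i.castSucc))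

end Wreath

/-! ### Monodromy groups of field extensions -/

section Fields

variable (A B C : Type u) [Field A] [Field B] [Field C] [Algebra A B] [Algebra B C] [Algebra A C]
  [IsScalarTower A B C]

/-- The geometric generic fibre: the set of `A`-embeddings of `B` into an algebraic closure
of `A`. -/
abbrev GeomFiber : Type u := B →ₐ[A] AlgebraicClosure A

/-- The action of the absolute Galois group of `A` on the geometric generic fibre. -/
noncomputable def galoisAction : Gal(AlgebraicClosure A/A) →* Equiv.Perm (GeomFiber A B) where
  toFun σ :=
    { toFun := fun x => (σ : AlgebraicClosure A →ₐ[A] AlgebraicClosure A).comp x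
      invFun := fun x => ((σ⁻¹ : Gal(AlgebraicClosure A/A)) :
        AlgebraicClosure A →ₐ[A] AlgebraicClosure A).comp x
      left_inv := fun x => by ext b; exact σ.symm_apply_apply (x b)
      right_inv := fun x => by ext b; exact σ.apply_symm_apply (x b) }
  map_one' := by ext; rfl
  map_mul' _ _ := by ext; rfl

/-- The monodromy group of `B/A`: the image of the absolute Galois group of `A` in the
permutations of the geometric generic fibre. For a finite separable extension this is the Galois
group of the Galois closure of `B/A`, with its action on the conjugates of `B`. -/
noncomputable def fieldMonodromy : Subgroup (Equiv.Perm (GeomFiber A B)) := (galoisAction A B).range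

/-- The natural map from the fibre of `C/A` to the fibre of `B/A`, by restriction to `B`. Its own
fibres are the blocks, each of which is a copy of the fibre of `C/B`. -/
noncomputable def restrictFiber (x : GeomFiber A C) : GeomFiber A B := x.comp (IsScalarTower.toAlgHom A B C)

/-- The kernel of the projection from the monodromy group of `C/A` to that of `B/A`, i.e. the
elements of the former that induce the identity on the fibre of `B/A`. -/
noncomputable def monodromyKernel : Subgroup (Equiv.Perm (GeomFiber A C)) where
  carrier := {σ | σ ∈ fieldMonodromy A C ∧
    ∀ x, restrictFiber A B C (σ x) = restrictFiber A B C x}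
  one_mem' := ⟨one_mem _, fun _ => rfl⟩
  mul_mem' := fun ha hb => ⟨mul_mem ha.1 hb.1, fun x => (ha.2 _).trans (hb.2 x)⟩
  inv_mem' := fun {σ} h => ⟨inv_mem h.1, fun x => by
    have := h.2 (σ⁻¹ x)
    rw [← this, ← Equiv.Perm.mul_apply, mul_inv_cancel, Equiv.Perm.one_apply]⟩

/-- The projection of the kernel to the coordinate `y`, where `y` is a point of the fibre of `B/A`:
the kernel acts on the block of all points above `y`. -/
noncomputable def kernelCoord (y : GeomFiber A B) (σ : monodromyKernel A B C) :
    Equiv.Perm {x : GeomFiber A C // restrictFiber A B C x = y} :=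
  (σ : Equiv.Perm (GeomFiber A C)).subtypePerm (fun x => by rw [σ.2.2 x])

/-- The kernel of the projection is diagonal: its projection to each coordinate is injective. -/
def IsDiagonalKernel : Prop := ∀ y : GeomFiber A B, Function.Injective (kernelCoord A B C y)

end Fields

/-! ### Maps of schemes -/

section Maps

variable {X Y Z : Scheme.{u}} [IsIntegral X] [IsIntegral Y] [IsIntegral Z]

theorem map_genericPoint (f : X ⟶ Y) [IsDominant f] : f (genericPoint X) = genericPoint Y := by
  apply ((genericPoint_spec Y).eq _).symm
  have h := (genericPoint_spec X).image f.continuous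
  rwa [Set.image_univ, f.denseRange.closure_range] at h

/-- The pullback map of function fields `F(Y) → F(X)` of a dominant morphism `f : X → Y`. -/
noncomputable def functionFieldMap (f : X ⟶ Y) [IsDominant f] :
    Y.functionField →+* X.functionField :=
  (Y.presheaf.stalkSpecializes (specializes_of_eq (map_genericPoint f)) ≫
    f.stalkMap (genericPoint X)).hom

theorem functionFieldMap_comp (h : X ⟶ Y) (g : Y ⟶ Z) [IsDominant h] [IsDominant g] :
    functionFieldMap (h ≫ g) = (functionFieldMap h).comp (functionFieldMap g) := by
  simp only [functionFieldMap, ← CommRingCat.hom_comp]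
  congr 1
  have e := Scheme.Hom.stalkSpecializes_stalkMap g _ _ (specializes_of_eq (map_genericPoint h))
  rw [Category.assoc, ← Category.assoc (g.stalkMap _), ← e, Category.assoc, ← Category.assoc,
    TopCat.Presheaf.stalkSpecializes_comp, Scheme.Hom.stalkMap_comp]
  rfl

/-- The function field extension `F(X)/F(Y)` of a dominant morphism `f : X → Y`. -/
noncomputable abbrev functionFieldAlgebra (f : X ⟶ Y) [IsDominant f] :
    Algebra Y.functionField X.functionField :=
  (functionFieldMap f).toAlgebra

/-- The geometric generic fibre of `f : X → Y`: the embeddings over `F(Y)` of `F(X)` into an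
algebraic closure of `F(Y)`. -/
def MapFiber (f : X ⟶ Y) [IsDominant f] : Type u :=
  letI := functionFieldAlgebra f
  GeomFiber Y.functionField X.functionField

/-- The monodromy group of `f : X → Y`, as a permutation group of the geometric generic fibre. -/
noncomputable def MonodromyGroup (f : X ⟶ Y) [IsDominant f] : Subgroup (Equiv.Perm (MapFiber f)) :=
  letI := functionFieldAlgebra f
  fieldMonodromy Y.functionField X.functionField

/-- The socle of the monodromy group of `f`, as a permutation group of the fibre of `f`. -/
noncomputable def socMon (f : X ⟶ Y) [IsDominant f] : Subgroup (Equiv.Perm (MapFiber f)) :=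
  (socle (MonodromyGroup f)).map (MonodromyGroup f).subtype

/-- `f : X → Y` is indecomposable (up to birational equivalence): its degree is greater than one
and there is no field strictly between `F(Y)` and `F(X)`. -/
def IsIndecomposableMap (f : X ⟶ Y) [IsDominant f] : Prop :=
  letI := functionFieldAlgebra f
  IsSimpleOrder (IntermediateField Y.functionField X.functionField)

/-- The Galois closure of `f : X → Y`, given by its function field: the normal closure of
`F(X)/F(Y)` in the fixed algebraic closure of `F(Y)`. -/
noncomputable def mapGaloisClosure (f : X ⟶ Y) [IsDominant f] :
    IntermediateField Y.functionField (AlgebraicClosure Y.functionField) :=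
  letI := functionFieldAlgebra f
  IntermediateField.normalClosure Y.functionField X.functionField
    (AlgebraicClosure Y.functionField)

/-- The kernel of the projection `Mon(g ∘ h) → Mon(g)` is a diagonal subgroup of
`Mon(h)^(deg g)`. -/
def HasDiagonalKernel (h : X ⟶ Y) (g : Y ⟶ Z) [IsDominant h] [IsDominant g] : Prop :=
  letI := functionFieldAlgebra h
  letI := functionFieldAlgebra g
  letI := functionFieldAlgebra (h ≫ g)
  haveI : IsScalarTower Z.functionField Y.functionField X.functionField :=
    .of_algebraMap_eq' (functionFieldMap_comp h g)
  IsDiagonalKernel Z.functionField Y.functionField X.functionField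

/-- A decomposition of `f : X → Y` into `s` indecomposable maps, up to birational equivalence: a
maximal chain `F(Y) = M₀ < M₁ < ⋯ < M_s = F(X)` of intermediate fields. -/
def IsCompleteDecomposition (f : X ⟶ Y) [IsDominant f] {s : ℕ}
    (M : Fin (s + 1) → Subfield X.functionField) : Prop :=
  M 0 = (functionFieldMap f).fieldRange ∧ M (Fin.last s) = ⊤ ∧
    ∀ i : Fin s, M i.castSucc ⋖ M i.succ

end Maps

/-- A sequence `X_r → X_{r-1} → ⋯ → X_0` of finite dominant morphisms of integral schemes over the
field `F`. It is recorded as a diagram, which contains the composites `X_j → X_i` for `i ≤ j`. -/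
structure MapSequence (F : Type u) [Field F] (r : ℕ) where
  diagram : (Fin (r + 1))ᵒᵖ ⥤ Over (Spec (.of F))
  isIntegral : ∀ i, IsIntegral (diagram.obj i).left
  isFinite : ∀ {i j} (e : i ⟶ j), IsFinite (diagram.map e).left
  isDominant : ∀ {i j} (e : i ⟶ j), IsDominant (diagram.map e).left

namespace MapSequence

variable {F : Type u} [Field F] {r : ℕ} (S : MapSequence F r)

/-- The scheme `X_i`. -/
noncomputable def obj (i : Fin (r + 1)) : Scheme.{u} := (S.diagram.obj (.op i)).left

instance (i : Fin (r + 1)) : IsIntegral (S.obj i) := S.isIntegral _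

/-- The composite map `X_j → X_i`, for `i ≤ j`. -/
noncomputable def map {i j : Fin (r + 1)} (h : i ≤ j) : S.obj j ⟶ S.obj i :=
  (S.diagram.map (homOfLE h).op).left

instance {i j : Fin (r + 1)} (h : i ≤ j) : IsDominant (S.map h) := S.isDominant _

/-- The map `f_i : X_i → X_{i-1}` (indexed from `0`). -/
noncomputable def step (i : Fin r) : S.obj i.succ ⟶ S.obj i.castSucc := S.map i.castSucc_le_succ

/-- The partial composition `g_i = f_1 ∘ ⋯ ∘ f_i : X_i → X_0`. -/
noncomputable def partialComp (i : Fin (r + 1)) : S.obj i ⟶ S.obj 0 := S.map i.zero_le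

instance (i : Fin r) : IsDominant (S.step i) := S.isDominant _

instance (i : Fin (r + 1)) : IsDominant (S.partialComp i) := S.isDominant _

end MapSequence

-- Let `A` be the absolute Galois group of `F(X_0)` and let `P_i` be the geometric generic fibre of
-- `g_i`. These are finite transitive `A`-sets forming a tower `P_r → ⋯ → P_0`, with `P_0` a point.
-- An isomorphism of algebraic closures identifies the group induced on a fibre of `P_i → P_{i-1}`
-- by its stabilizer with `Γ_i`. Indecomposability makes the stabilizer of a point maximal in the
-- stabilizer of its image. Both conclusions thus become statements about one tower of permutation
-- representations.
--
-- The main claim concerns the normal subgroup `M` of elements that fix `P_{i-1}` pointwise and act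
-- on every fibre through the socle (`socleKernel`): it maps onto the full product of the socles of
-- the fibre groups (`tower_full_product`). Distinct Galois closures give elements fixing `P_{i-1}`
-- but not `P_i`; for the first step, indecomposability does this. A minimality argument then puts a
-- nontrivial action into `M` (`exists_mem_socleKernel_smul_ne`), and `M` surjects onto each socle
-- because the socle is the least nontrivial normal subgroup of a fibre group. For nonabelian simple
-- targets such a subdirect image is the full product unless two projections have the same kernel
-- (`exists_forall_eq_of_ker_injective`). Equality of kernels is an `A`-invariant equivalence
-- relation on `P_{i-1}`. If it is nontrivial, the classification of overgroups one level below
-- forces a whole fibre of `P_{i-1} → P_{i-2}` into one class; a commutator argument then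
-- contradicts nondiagonality (`eq_of_ker_socleProj_eq`).
--
-- The full product also classifies overgroups at the next level: an overgroup of a point stabilizer
-- that moves the image of the point contains `M`, and hence the stabilizer of that image
-- (`eq_or_stabilizer_le`). The two statements are therefore proved in a single induction
-- (`tower_stabilizers`), and the Galois correspondence turns the second into (b). For (a), the
-- kernel of `Mon(g_i) → Mon(g_{i-1})` has a normal subgroup isomorphic to the product of socles,
-- which is the kernel of the corresponding wreath product projection; composition factors add up
-- along extensions (`tower_factorsContain`).

universe w

/-! ### Composition factors -/

/-- Isomorphism classes of groups. -/
def GroupClass : Type (u + 1) := Quotient (isIsomorphicSetoid GrpCat.{u})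

/-- The isomorphism class of a group. -/
def groupClass (G : Type u) [Group G] : GroupClass.{u} :=
  Quotient.mk (isIsomorphicSetoid GrpCat.{u}) (GrpCat.of G)

theorem groupClass_eq_iff {G H : Type u} [Group G] [Group H] :
    groupClass G = groupClass H ↔ Nonempty (G ≃* H) := by
  refine (Quotient.eq (r := isIsomorphicSetoid GrpCat.{u})).trans ⟨?_, ?_⟩
  · rintro ⟨e⟩
    exact ⟨e.groupIsoToMulEquiv⟩
  · rintro ⟨e⟩
    exact ⟨e.toGrpIso⟩

/-- `G` has a composition series whose multiset of factors is `m`. -/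
inductive HasFactors : (G : Type u) → [Group G] → Multiset GroupClass.{u} → Prop
  | triv (G : Type u) [Group G] (h : Subsingleton G) : HasFactors G 0
  | cons (G : Type u) [Group G] (T : Type u) [Group T] (hT : IsSimpleGroup T) (φ : G →* T)
      (hφ : Function.Surjective φ) (m : Multiset GroupClass.{u}) (h : HasFactors φ.ker m) :
      HasFactors G (groupClass T ::ₘ m)

theorem HasFactors.of_mulEquiv {G : Type u} [Group G] {m : Multiset GroupClass.{u}}
    (h : HasFactors G m) : ∀ {H : Type u} [Group H] (_ : G ≃* H), HasFactors H m := by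
  induction h with
  | triv G h =>
    intro H _ e
    exact .triv H e.symm.toEquiv.subsingleton
  | cons G T hT φ hφ m h ih =>
    intro H _ e
    refine .cons H T hT (φ.comp e.symm.toMonoidHom) (hφ.comp e.symm.surjective) m (ih ?_)
    refine (e.subgroupMap φ.ker).trans (MulEquiv.subgroupCongr ?_)
    ext x
    simp [MonoidHom.mem_ker]

/-- A simple quotient of `H` is also one of `G`, and its kernel in `G` is an extension of the
smaller kernel in `H` by the same `φ.ker`; so one inducts on the factors of `H`. -/
theorem HasFactors.extension {H : Type u} [Group H] {m : Multiset GroupClass.{u}}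
    (h : HasFactors H m) : ∀ {G : Type u} [Group G] {n : Multiset GroupClass.{u}} (φ : G →* H)
    (_ : Function.Surjective φ) (_ : HasFactors φ.ker n), HasFactors G (m + n) := by
  induction h with
  | triv H h =>
    intro G _ n φ hφ hn
    rw [zero_add]
    have : φ.ker = ⊤ := by
      ext x; simp [MonoidHom.mem_ker, Subsingleton.elim (φ x) 1]
    exact hn.of_mulEquiv ((MulEquiv.subgroupCongr this).trans Subgroup.topEquiv)
  | cons H T hT ψ hψ m h ih =>
    intro G _ n φ hφ hn
    rw [Multiset.cons_add]
    refine .cons G T hT (ψ.comp φ) (hψ.comp hφ) _ ?_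
    have key : ∀ x, x ∈ (ψ.comp φ).ker → φ x ∈ ψ.ker := fun x hx => hx
    let φ' : (ψ.comp φ).ker →* ψ.ker :=
      (φ.comp (ψ.comp φ).ker.subtype).codRestrict ψ.ker (fun x => key _ x.2)
    refine ih φ' ?_ ?_
    · rintro ⟨y, hy⟩
      obtain ⟨x, rfl⟩ := hφ y
      exact ⟨⟨x, hy⟩, rfl⟩
    · refine hn.of_mulEquiv ?_
      refine MulEquiv.mk' ⟨fun x => ⟨⟨x.1, ?_⟩, ?_⟩, fun x => ⟨x.1.1, ?_⟩, fun _ => rfl,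
        fun _ => rfl⟩ fun _ _ => rfl
      · change ψ (φ x.1) = 1
        rw [show φ x.1 = 1 from x.2, map_one]
      · exact Subtype.ext x.2
      · exact congrArg Subtype.val x.2

theorem exists_maximal_normal (G : Type u) [Group G] [Finite G] [Nontrivial G] :
    ∃ N : Subgroup G, ∃ _ : N.Normal, IsSimpleGroup (G ⧸ N) := by
  obtain ⟨N, hN⟩ := (Set.toFinite {N : Subgroup G | N.Normal ∧ N ≠ ⊤}).exists_maximal
    ⟨⊥, inferInstance, bot_ne_top⟩
  have := hN.prop.1
  refine ⟨N, hN.prop.1, ?_⟩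
  have : Nontrivial (G ⧸ N) := QuotientGroup.nontrivial_iff.2 hN.prop.2
  refine ⟨fun H hH => ?_⟩
  by_cases hT : H.comap (QuotientGroup.mk' N) = ⊤
  · right
    rw [← Subgroup.map_comap_eq_self_of_surjective (QuotientGroup.mk'_surjective N) H, hT,
      ← MonoidHom.range_eq_map, MonoidHom.range_eq_top.2 (QuotientGroup.mk'_surjective N)]
  · left
    have hle : N ≤ H.comap (QuotientGroup.mk' N) := by
      intro x hx
      rw [Subgroup.mem_comap, QuotientGroup.mk'_apply, (QuotientGroup.eq_one_iff x).2 hx]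
      exact H.one_mem
    have := hN.eq_of_le ⟨hH.comap _, hT⟩ hle
    rw [← Subgroup.map_comap_eq_self_of_surjective (QuotientGroup.mk'_surjective N) H, ← this]
    exact QuotientGroup.map_mk'_self N

theorem exists_hasFactors (n : ℕ) : ∀ (G : Type u) [Group G] [Finite G], Nat.card G = n →
    ∃ m, HasFactors G m := by
  induction n using Nat.strong_induction_on with
  | _ n ih =>
    intro G _ _ hn
    rcases subsingleton_or_nontrivial G with h | h
    · exact ⟨0, .triv G h⟩
    · obtain ⟨N, hN, hs⟩ := exists_maximal_normal G
      have hlt : Nat.card (QuotientGroup.mk' N).ker < n := by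
        rw [QuotientGroup.ker_mk', ← hn]
        refine lt_of_le_of_ne (Subgroup.card_le_card_group N) fun h => ?_
        have := hs.toNontrivial
        rw [QuotientGroup.nontrivial_iff] at this
        exact this (Subgroup.eq_top_of_card_eq N h)
      obtain ⟨m, hm⟩ := ih _ hlt (QuotientGroup.mk' N).ker rfl
      exact ⟨_, .cons G _ hs (QuotientGroup.mk' N) (QuotientGroup.mk'_surjective N) m hm⟩

/-! ### From iterated extensions to composition series -/

/-- The multiset of factors of a composition series. -/
noncomputable def GroupCompositionSeries.factors {G : Type u} [Group G]
    (s : GroupCompositionSeries G) : Multiset GroupClass.{u} :=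
  Finset.univ.val.map fun i => groupClass (s.Factor i)

/-- `E ⊲ E'` with quotient isomorphic to `T`. -/
def IsFactor {G : Type u} [Group G] (E E' : Subgroup G) (T : Type v) [Group T] : Prop :=
  E ≤ E' ∧ ∃ ψ : E' →* T, Function.Surjective ψ ∧ ψ.ker = E.subgroupOf E'

theorem IsFactor.map {G H : Type u} [Group G] [Group H] {E E' : Subgroup G} {T : Type v} [Group T]
    (h : IsFactor E E' T) (f : G →* H) (hf : Function.Injective f) :
    IsFactor (E.map f) (E'.map f) T := by
  obtain ⟨hle, ψ, hψ, hk⟩ := h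
  let e := E'.equivMapOfInjective f hf
  refine ⟨Subgroup.map_mono hle, ψ.comp e.symm.toMonoidHom, hψ.comp e.symm.surjective, ?_⟩
  ext x
  obtain ⟨y, rfl⟩ := e.surjective x
  have h1 : ψ y = 1 ↔ y.1 ∈ E := by
    rw [← MonoidHom.mem_ker, hk, Subgroup.mem_subgroupOf]
  simp only [MonoidHom.mem_ker, MonoidHom.comp_apply, MulEquiv.coe_toMonoidHom,
    MulEquiv.symm_apply_apply, Subgroup.mem_subgroupOf, h1]
  rw [show ((e y : E'.map f) : H) = f y from rfl, Subgroup.mem_map_iff_mem hf]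

theorem GroupCompositionSeries.isFactor {G : Type u} [Group G] (s : GroupCompositionSeries G)
    (i : Fin s.length) : IsFactor (s.term i.castSucc) (s.term i.succ) (s.Factor i) := by
  have := s.normal i
  exact ⟨s.le_succ i, QuotientGroup.mk' ((s.term i.castSucc).subgroupOf (s.term i.succ)),
    QuotientGroup.mk'_surjective _, QuotientGroup.ker_mk' _⟩

theorem exists_series_of_isFactor {G : Type u} [Group G] (n : ℕ) (E : Fin (n + 1) → Subgroup G)
    (c : Fin n → GroupClass.{u}) (h0 : E 0 = ⊥) (h1 : E (Fin.last n) = ⊤)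
    (h : ∀ i : Fin n, ∃ (T : Type u) (_ : Group T), IsSimpleGroup T ∧ groupClass T = c i ∧
      IsFactor (E i.castSucc) (E i.succ) T) :
    ∃ s : GroupCompositionSeries G, s.factors = Finset.univ.val.map c := by
  have hn : ∀ i : Fin n, ((E i.castSucc).subgroupOf (E i.succ)).Normal := fun i => by
    obtain ⟨T, _, -, -, -, ψ, -, hk⟩ := h i
    rw [← hk]
    infer_instance
  have he : ∀ i : Fin n, ∃ (T : Type u) (_ : Group T), IsSimpleGroup T ∧ groupClass T = c i ∧
      Nonempty (E i.succ ⧸ (E i.castSucc).subgroupOf (E i.succ) ≃* T) := fun i => by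
    obtain ⟨T, _, hs, hc, -, ψ, hψ, hk⟩ := h i
    exact ⟨T, _, hs, hc, ⟨(QuotientGroup.quotientMulEquivOfEq hk.symm).trans
      (QuotientGroup.quotientKerEquivOfSurjective ψ hψ)⟩⟩
  refine ⟨⟨n, E, h0, h1, fun i => ?_, hn, fun i => ?_⟩, ?_⟩
  · obtain ⟨T, _, -, -, hle, -⟩ := h i
    exact hle
  · obtain ⟨T, _, hs, -, ⟨e⟩⟩ := he i
    exact e.isSimpleGroup
  · refine Multiset.map_congr rfl fun i _ => ?_
    obtain ⟨T, _, -, hc, ⟨e⟩⟩ := he i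
    rw [← hc]
    exact groupClass_eq_iff.2 ⟨e⟩

theorem HasFactors.exists_series {G : Type u} [Group G] {m : Multiset GroupClass.{u}}
    (h : HasFactors G m) : ∃ s : GroupCompositionSeries G, s.factors = m := by
  induction h with
  | triv G h =>
    refine ⟨⟨0, fun _ => ⊥, rfl, Subsingleton.elim _ _, fun i => i.elim0, fun i => i.elim0,
      fun i => i.elim0⟩, rfl⟩
  | cons G T hT φ hφ m h ih =>
    obtain ⟨s, hs⟩ := ih
    -- The series of the kernel is pushed into `G` and `⊤` is appended as its last term; the new top
    -- factor is `T`.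
    let E : Fin (s.length + 1 + 1) → Subgroup G :=
      fun i => if hi : i.1 < s.length + 1 then (s.term ⟨i, hi⟩).map φ.ker.subtype else ⊤
    have hE : ∀ i : Fin (s.length + 1), E i.castSucc = (s.term i).map φ.ker.subtype :=
      fun i => dif_pos i.2
    have hE' : E (Fin.last _) = ⊤ := dif_neg (lt_irrefl _)
    have h0 : E 0 = ⊥ := (hE 0).trans (by rw [s.term_zero, Subgroup.map_bot])
    obtain ⟨t, ht⟩ := exists_series_of_isFactor (s.length + 1) E
      (Fin.snoc (fun i => groupClass (s.Factor i)) (groupClass T)) h0 hE' (by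
        intro i
        induction i using Fin.lastCases with
        | last =>
          refine ⟨T, _, hT, by rw [Fin.snoc_last], ?_⟩
          rw [Fin.succ_last, hE', hE, s.term_last, ← MonoidHom.range_eq_map, Subgroup.range_subtype]
          refine ⟨le_top, φ.comp (Subgroup.subtype ⊤), fun t => ?_, rfl⟩
          obtain ⟨x, rfl⟩ := hφ t
          exact ⟨⟨x, trivial⟩, rfl⟩
        | cast i =>
          refine ⟨s.Factor i, inferInstance, s.simple i, by rw [Fin.snoc_castSucc], ?_⟩
          rw [hE, Fin.succ_castSucc, hE]
          exact (s.isFactor i).map _ φ.ker.subtype_injective)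
    refine ⟨t, ht.trans ?_⟩
    rw [← hs, GroupCompositionSeries.factors, Fin.univ_val_map, Fin.univ_val_map, List.ofFn_succ']
    simp only [Fin.snoc_castSucc, Fin.snoc_last, List.concat_eq_append]
    rw [← Multiset.coe_add, add_comm]
    rfl

/-- Multiplicities are cardinalities of fibres, so each fibre of `f` embeds in the fibre of `g` over
the same value, and these embeddings are glued. -/
theorem exists_embedding_of_map_le {α : Type v} {a b : ℕ} (f : Fin a → α) (g : Fin b → α)
    (h : Finset.univ.val.map f ≤ Finset.univ.val.map g) :
    ∃ e : Fin a ↪ Fin b, ∀ i, f i = g (e i) := by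
  classical
  have key : ∀ c : α, Nonempty ({i // f i = c} ↪ {j // g j = c}) := fun c => by
    refine Function.Embedding.nonempty_of_card_le ?_
    have := Multiset.count_le_of_le c h
    rw [Multiset.count_map, Multiset.count_map] at this
    rw [Fintype.card_subtype, Fintype.card_subtype]
    simpa [Finset.card, Finset.filter, eq_comm] using this
  have k := fun c => Classical.choice (key c)
  refine ⟨⟨fun i => (k (f i) ⟨i, rfl⟩).1, fun i j hij => ?_⟩, fun i => (k (f i) ⟨i, rfl⟩).2.symm⟩
  have h1 : f i = f j := by
    rw [← (k (f i) ⟨i, rfl⟩).2, ← (k (f j) ⟨j, rfl⟩).2]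
    exact congrArg g hij
  -- Each `k c` is injective only within one value `c`, so both indices must first be viewed over a
  -- common value.
  have h2 : ∀ c (hc : f i = c) (hd : f j = c), (k c ⟨i, hc⟩).1 = (k c ⟨j, hd⟩).1 → i = j :=
    fun c hc hd h => congrArg Subtype.val ((k c).injective (Subtype.ext h))
  refine h2 (f j) h1 rfl ?_
  have h3 : ∀ c (hc : f i = c), (k c ⟨i, hc⟩).1 = (k (f i) ⟨i, rfl⟩).1 := by
    rintro c rfl
    rfl
  exact (h3 _ h1).trans hij

theorem HasFactors.containsCompositionFactors {G W : Type u} [Group G] [Group W]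
    {m n : Multiset GroupClass.{u}} (hG : HasFactors G m) (hW : HasFactors W n) (h : n ≤ m) :
    ContainsCompositionFactors G W := by
  obtain ⟨s, rfl⟩ := hG.exists_series
  obtain ⟨t, rfl⟩ := hW.exists_series
  obtain ⟨e, he⟩ := exists_embedding_of_map_le _ _ h
  exact ⟨s, t, e, fun i => groupClass_eq_iff.1 (he i)⟩

/-- The multiset of factors of some composition series of `W` is contained in that of some
composition series of `G`. -/
def FactorsContain (G W : Type u) [Group G] [Group W] : Prop :=
  ∃ m n : Multiset GroupClass.{u}, HasFactors G m ∧ HasFactors W n ∧ n ≤ m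

theorem FactorsContain.containsCompositionFactors {G W : Type u} [Group G] [Group W]
    (h : FactorsContain G W) : ContainsCompositionFactors G W := by
  obtain ⟨m, n, hm, hn, h⟩ := h
  exact hm.containsCompositionFactors hn h

theorem FactorsContain.of_mulEquiv {G G' W W' : Type u} [Group G] [Group G'] [Group W] [Group W']
    (h : FactorsContain G W) (e : G ≃* G') (e' : W ≃* W') : FactorsContain G' W' := by
  obtain ⟨m, n, hm, hn, h⟩ := h
  exact ⟨m, n, hm.of_mulEquiv e, hn.of_mulEquiv e', h⟩

theorem FactorsContain.of_subsingleton (G W : Type u) [Group G] [Finite G] [Group W]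
    [h : Subsingleton W] : FactorsContain G W := by
  obtain ⟨m, hm⟩ := exists_hasFactors _ G rfl
  exact ⟨m, 0, hm, .triv W h, zero_le⟩

/-- The inductive step for (a): containment may be checked separately on quotients and on kernels,
without any homomorphism between `G` and `W`. -/
theorem FactorsContain.extension {G H W V : Type u} [Group G] [Group H] [Group W] [Group V]
    (φ : G →* H) (hφ : Function.Surjective φ) (ψ : W →* V) (hψ : Function.Surjective ψ)
    (h : FactorsContain H V) (hk : FactorsContain φ.ker ψ.ker) : FactorsContain G W := by
  obtain ⟨m, n, hm, hn, h⟩ := h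
  obtain ⟨m', n', hm', hn', h'⟩ := hk
  exact ⟨m + m', n + n', hm.extension φ hφ hm', hn.extension ψ hψ hn', add_le_add h h'⟩

theorem FactorsContain.of_normal {G : Type u} [Group G] [Finite G] (N : Subgroup G) [N.Normal] :
    FactorsContain G N := by
  obtain ⟨m, hm⟩ := exists_hasFactors _ (G ⧸ N) rfl
  obtain ⟨n, hn⟩ := exists_hasFactors _ N rfl
  refine ⟨m + n, n, hm.extension (QuotientGroup.mk' N) (QuotientGroup.mk'_surjective N) ?_, hn,
    Multiset.le_add_left _ _⟩
  rw [QuotientGroup.ker_mk']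
  exact hn

/-! ### Almost simple groups -/

/-- The socle of a subgroup, as a subgroup of the ambient group. -/
def innerSocle {P : Type u} [Group P] (G : Subgroup P) : Subgroup P := (socle G).map G.subtype

theorem socle_map_mulEquiv {G H : Type u} [Group G] [Group H] (e : G ≃* H) :
    (socle G).map (e : G →* H) = socle H := by
  have key : ∀ {G H : Type u} [Group G] [Group H] (e : G ≃* H) (N : Subgroup G),
      Minimal (fun M : Subgroup G => M.Normal ∧ M ≠ ⊥) N →
      Minimal (fun M : Subgroup H => M.Normal ∧ M ≠ ⊥) (N.map (e : G →* H)) := by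
    intro G H _ _ e N hN
    refine ⟨⟨hN.prop.1.map _ e.surjective, fun h => hN.prop.2 ?_⟩, fun M hM hle => ?_⟩
    · exact (Subgroup.map_eq_bot_iff_of_injective N e.injective).1 h
    · have h1 : M.comap (e : G →* H) ≤ N := by
        intro x hx
        obtain ⟨y, hy, hxy⟩ := hle hx
        rwa [← e.injective hxy]
      have h2 := hN.le_of_le ⟨hM.1.comap _, fun h => hM.2 ?_⟩ h1
      · rw [Subgroup.map_le_iff_le_comap]
        exact h2
      · rw [← Subgroup.map_comap_eq_self_of_surjective (f := (e : G →* H)) e.surjective M, h,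
          Subgroup.map_bot]
  have le : ∀ {G H : Type u} [Group G] [Group H] (e : G ≃* H),
      (socle G).map (e : G →* H) ≤ socle H := by
    intro G H _ _ e
    rw [Subgroup.map_le_iff_le_comap]
    refine sSup_le fun N hN => ?_
    rw [← Subgroup.map_le_iff_le_comap]
    exact le_sSup (key e N hN)
  refine le_antisymm (le e) fun x hx => ⟨e.symm x, ?_, e.apply_symm_apply x⟩
  exact le e.symm ⟨x, hx, rfl⟩

theorem innerSocle_map {P Q : Type u} [Group P] [Group Q] (e : P ≃* Q) (G : Subgroup P) :
    innerSocle (G.map (e : P →* Q)) = (innerSocle G).map (e : P →* Q) := by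
  rw [innerSocle, innerSocle, ← socle_map_mulEquiv (e.subgroupMap G), Subgroup.map_map,
    Subgroup.map_map]
  rfl

theorem IsNonabelianAlmostSimple.of_mulEquiv {G H : Type u} [Group G] [Group H] (e : G ≃* H)
    (h : IsNonabelianAlmostSimple G) : IsNonabelianAlmostSimple H := by
  obtain ⟨L, hn, hs, ⟨x, y, hxy⟩, hc⟩ := h
  refine ⟨L.map (e : G →* H), hn.map _ e.surjective, (e.subgroupMap L).symm.isSimpleGroup,
    ⟨e.subgroupMap L x, e.subgroupMap L y, fun h => hxy ?_⟩, ?_⟩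
  · exact (e.subgroupMap L).injective (((e.subgroupMap L).map_mul x y).trans
      (h.trans ((e.subgroupMap L).map_mul y x).symm))
  · rw [eq_bot_iff]
    intro z hz
    rw [Subgroup.mem_centralizer_iff] at hz
    have : e.symm z ∈ Subgroup.centralizer (L : Set G) := by
      rw [Subgroup.mem_centralizer_iff]
      intro l hl
      apply e.injective
      simpa using hz (e l) ⟨l, hl, rfl⟩
    rw [hc, Subgroup.mem_bot] at this
    rw [Subgroup.mem_bot]
    simpa using this

/-- A normalized nontrivial subgroup of an almost simple group contains the simple normal
subgroup. -/
theorem le_of_normalized {G : Type u} [Group G] {L : Subgroup G} (hn : L.Normal)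
    (hs : IsSimpleGroup L) (hc : Subgroup.centralizer (L : Set G) = ⊥) {Q : Subgroup G}
    (hQ : Q ≠ ⊥) (hLQ : ∀ l ∈ L, ∀ q ∈ Q, l * q * l⁻¹ ∈ Q) : L ≤ Q := by
  obtain ⟨⟨q, hq⟩, hq1'⟩ := Subgroup.ne_bot_iff_exists_ne_one.1 hQ
  have hq1 : q ≠ 1 := fun h => hq1' (Subtype.ext h)
  have hq2 : q ∉ Subgroup.centralizer (L : Set G) := by
    rwa [hc, Subgroup.mem_bot]
  rw [Subgroup.mem_centralizer_iff] at hq2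
  push Not at hq2
  obtain ⟨l, hl, hlq⟩ := hq2
  -- The commutator of `l` and `q` lies in `L` by normality and in `Q` because `L` normalizes `Q`.
  -- It is nontrivial, so `Q ∩ L` is a nontrivial normal subgroup of the simple group `L`.
  have hcL : l * q * l⁻¹ * q⁻¹ ∈ L := by
    have := L.mul_mem hl (hn.conj_mem _ (L.inv_mem hl) q)
    simpa [mul_assoc] using this
  have hcQ : l * q * l⁻¹ * q⁻¹ ∈ Q := Q.mul_mem (hLQ l hl q hq) (Q.inv_mem hq)
  have hnorm : (Q.subgroupOf L).Normal := ⟨fun x hx g => by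
    rw [Subgroup.mem_subgroupOf] at hx ⊢
    exact hLQ g g.2 x hx⟩
  rcases hs.eq_bot_or_eq_top_of_normal _ hnorm with h | h
  · exfalso
    have : (⟨_, hcL⟩ : L) ∈ Q.subgroupOf L := hcQ
    rw [h, Subgroup.mem_bot] at this
    have h3 : l * q * l⁻¹ * q⁻¹ = 1 := congrArg Subtype.val this
    apply hlq
    rw [mul_inv_eq_one, mul_inv_eq_iff_eq_mul] at h3
    exact h3
  · exact Subgroup.subgroupOf_eq_top.1 h

/-- Every nontrivial normal subgroup contains the simple subgroup `L` of the definition, so `L` is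
the only minimal normal subgroup and equals the socle. -/
theorem IsNonabelianAlmostSimple.socle_spec {G : Type u} [Group G]
    (h : IsNonabelianAlmostSimple G) : (socle G).Normal ∧ IsSimpleGroup (socle G) ∧
      (∃ x y : socle G, x * y ≠ y * x) ∧ Subgroup.centralizer (socle G : Set G) = ⊥ := by
  obtain ⟨L, hn, hs, hxy, hc⟩ := h
  have hL : L ≠ ⊥ := fun h => by
    subst h
    exact not_nontrivial _ hs.toNontrivial
  have hmin : ∀ N : Subgroup G, N.Normal → N ≠ ⊥ → L ≤ N := fun N hN h =>
    le_of_normalized hn hs hc h fun l _ q hq => hN.conj_mem q hq l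
  have : socle G = L := by
    refine le_antisymm (sSup_le fun N hN => ?_) (le_sSup ⟨⟨hn, hL⟩, fun N hN _ => hmin N hN.1 hN.2⟩)
    have hN : Minimal (fun M : Subgroup G => M.Normal ∧ M ≠ ⊥) N := hN
    exact hN.le_of_le ⟨hn, hL⟩ (hmin N hN.prop.1 hN.prop.2)
  rw [this]
  exact ⟨hn, hs, hxy, hc⟩

/-! ### Socles of almost simple subgroups of an ambient group -/

section InnerSocle

variable {P : Type u} [Group P] {G : Subgroup P} (h : IsNonabelianAlmostSimple G)

theorem innerSocle_le : innerSocle G ≤ G := Subgroup.map_subtype_le _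

/-- The inner socle is isomorphic to the socle. -/
noncomputable def innerSocleEquiv (G : Subgroup P) : socle G ≃* innerSocle G :=
  (socle G).equivMapOfInjective _ G.subtype_injective

include h

theorem conj_mem_innerSocle {g s : P} (hg : g ∈ G) (hs : s ∈ innerSocle G) :
    g * s * g⁻¹ ∈ innerSocle G := by
  obtain ⟨s, hs, rfl⟩ := hs
  exact ⟨⟨g, hg⟩ * s * ⟨g, hg⟩⁻¹, h.socle_spec.1.conj_mem s hs ⟨g, hg⟩, rfl⟩

theorem isSimpleGroup_innerSocle : IsSimpleGroup (innerSocle G) :=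
  have := h.socle_spec.2.1
  (innerSocleEquiv G).symm.isSimpleGroup

theorem innerSocle_noncomm : ∃ x y : innerSocle G, x * y ≠ y * x := by
  obtain ⟨x, y, hxy⟩ := h.socle_spec.2.2.1
  refine ⟨innerSocleEquiv G x, innerSocleEquiv G y, fun h => hxy ?_⟩
  rw [← map_mul, ← map_mul] at h
  exact (innerSocleEquiv G).injective h

theorem eq_one_of_commute_innerSocle {g : P} (hg : g ∈ G)
    (hc : ∀ s ∈ innerSocle G, g * s = s * g) : g = 1 := by
  have : (⟨g, hg⟩ : G) ∈ Subgroup.centralizer (socle G : Set G) := by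
    rw [Subgroup.mem_centralizer_iff]
    intro s hs
    exact Subtype.ext (hc s ⟨s, hs, rfl⟩).symm
  rw [h.socle_spec.2.2.2, Subgroup.mem_bot] at this
  exact congrArg Subtype.val this

theorem innerSocle_le_of_normalized {Q : Subgroup P} (hQG : Q ≤ G) (hQ : Q ≠ ⊥)
    (hSQ : ∀ s ∈ innerSocle G, ∀ q ∈ Q, s * q * s⁻¹ ∈ Q) : innerSocle G ≤ Q := by
  have := le_of_normalized h.socle_spec.1 h.socle_spec.2.1 h.socle_spec.2.2.2
    (Q := Q.subgroupOf G) (fun h => hQ ?_) (fun l hl q hq => hSQ l ⟨l, hl, rfl⟩ q hq)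
  · rintro _ ⟨s, hs, rfl⟩
    exact this hs
  · rw [Subgroup.subgroupOf_eq_bot] at h
    exact h.eq_bot_of_le hQG

theorem innerSocle_ne_bot : innerSocle G ≠ ⊥ := fun h' => by
  have := (isSimpleGroup_innerSocle h).toNontrivial
  rw [h'] at this
  exact not_nontrivial _ this

end InnerSocle

/-! ### Subdirect products of simple groups -/

section CRT

variable {M : Type*} [Group M] {ι : Type*} {L : ι → Type*} [∀ i, Group (L i)]
  (π : ∀ i, M →* L i) (hπ : ∀ i, Function.Surjective (π i)) [hs : ∀ i, IsSimpleGroup (L i)]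

include hπ hs

theorem map_eq_top_of_not_le_ker {N : Subgroup M} (hN : N.Normal) {i : ι} (h : ¬ N ≤ (π i).ker) :
    N.map (π i) = ⊤ :=
  ((hs i).eq_bot_or_eq_top_of_normal _ (hN.map _ (hπ i))).resolve_left
    fun h' => h ((Subgroup.map_eq_bot_iff N).1 h')

/-- Kernels of surjections onto simple groups are maximal normal subgroups: were the inclusion
strict, `(π i).ker` would surject onto `L j`, and with `(π j).ker` it would generate `M`, making `L
i` trivial. -/
theorem ker_eq_of_ker_le {i j : ι} (h : (π j).ker ≤ (π i).ker) : (π i).ker = (π j).ker := by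
  by_contra hne
  have h1 : ¬ (π i).ker ≤ (π j).ker := fun h' => hne (le_antisymm h' h)
  have h2 := map_eq_top_of_not_le_ker π hπ inferInstance h1
  obtain ⟨l, hl⟩ := exists_ne (1 : L i)
  obtain ⟨m, rfl⟩ := hπ i l
  obtain ⟨k, hk, hkm⟩ : π j m ∈ (π i).ker.map (π j) := h2 ▸ Subgroup.mem_top _
  refine hl ?_
  have : k⁻¹ * m ∈ (π j).ker := by simp [MonoidHom.mem_ker, hkm]
  have := h this
  rw [MonoidHom.mem_ker, map_mul, map_inv, MonoidHom.mem_ker.1 hk] at this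
  simpa using this

/-- A Chinese remainder theorem in which the kernels play the role of distinct maximal ideals, with
commutators in place of products; noncommutativity of the factors makes it work. -/
theorem exists_forall_eq_of_ker_injective [Finite ι] (hL : ∀ i, ∃ x y : L i, x * y ≠ y * x)
    (hinj : ∀ i j, (π i).ker = (π j).ker → i = j) (l : ∀ i, L i) : ∃ m, ∀ i, π i m = l i := by
  classical
  have := Fintype.ofFinite ι
  -- The kernels behave like prime ideals. If two normal subgroups both surject onto `L i`,
  -- commutators of lifts of noncommuting `x`, `y` lie in their intersection but not in `(π i).ker`.
  have prime : ∀ (s : Finset ι) (i : ι), (⨅ j ∈ s, (π j).ker) ≤ (π i).ker → i ∈ s := by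
    intro s i
    induction s using Finset.induction_on with
    | empty =>
      intro h
      obtain ⟨l, hl⟩ := exists_ne (1 : L i)
      obtain ⟨m, rfl⟩ := hπ i l
      exact (hl (h (by simp))).elim
    | insert j s hj ih =>
      intro h
      by_contra hi
      rw [Finset.mem_insert, not_or] at hi
      have hA := map_eq_top_of_not_le_ker π hπ (N := (π j).ker) inferInstance
        (i := i) fun h => hi.1 (hinj _ _ (ker_eq_of_ker_le π hπ h))
      have hB := map_eq_top_of_not_le_ker π hπ (N := ⨅ j ∈ s, (π j).ker)
        (Subgroup.normal_iInf_normal fun j => Subgroup.normal_iInf_normal fun _ => inferInstance)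
        (i := i) fun h => hi.2 (ih h)
      obtain ⟨x, y, hxy⟩ := hL i
      obtain ⟨a, ha, rfl⟩ : x ∈ (π j).ker.map (π i) := hA ▸ Subgroup.mem_top _
      obtain ⟨b, hb, rfl⟩ : y ∈ (⨅ j ∈ s, (π j).ker).map (π i) := hB ▸ Subgroup.mem_top _
      simp only [SetLike.mem_coe, Subgroup.mem_iInf, MonoidHom.mem_ker] at ha hb
      have hab : a * b * a⁻¹ * b⁻¹ ∈ ⨅ k ∈ insert j s, (π k).ker := by
        simp only [Subgroup.mem_iInf, MonoidHom.mem_ker, Finset.mem_insert]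
        rintro k (rfl | hk)
        · simp [ha]
        · simp [hb k hk]
      have := h hab
      rw [MonoidHom.mem_ker, map_mul, map_mul, map_mul, map_inv, map_inv, mul_inv_eq_one,
        mul_inv_eq_iff_eq_mul] at this
      exact hxy this
  have main : ∀ s : Finset ι, ∃ m, ∀ i ∈ s, π i m = l i := by
    intro s
    induction s using Finset.induction_on with
    | empty => exact ⟨1, by simp⟩
    | insert i s hi ih =>
      obtain ⟨m, hm⟩ := ih
      have hB := map_eq_top_of_not_le_ker π hπ (N := ⨅ j ∈ s, (π j).ker)
        (Subgroup.normal_iInf_normal fun j => Subgroup.normal_iInf_normal fun _ => inferInstance)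
        (i := i) fun h => hi (prime s i h)
      obtain ⟨b, hb, hb'⟩ : (π i m)⁻¹ * l i ∈ (⨅ j ∈ s, (π j).ker).map (π i) :=
        hB ▸ Subgroup.mem_top _
      simp only [SetLike.mem_coe, Subgroup.mem_iInf, MonoidHom.mem_ker] at hb
      refine ⟨m * b, fun j hj => ?_⟩
      rcases Finset.mem_insert.1 hj with rfl | hj
      · simp [hb']
      · simp [hb j hj, hm j hj]
  obtain ⟨m, hm⟩ := main Finset.univ
  exact ⟨m, fun i => hm i (Finset.mem_univ i)⟩

end CRT

section

open MulAction

/-! ### Equivariant maps of permutation representations -/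

section Step

variable {A : Type v} {Om : Type u} {Y : Type u} [Group A] [MulAction A Om] [MulAction A Y]
  (p : Om →[A] Y)

/-- The action of a point stabilizer on the fibre of an equivariant map. -/
def fiberHom (y : Y) : stabilizer A y →* Equiv.Perm {x // p x = y} where
  toFun a :=
    { toFun := fun x => ⟨a.1 • x.1, by rw [map_smul, x.2]; exact a.2⟩
      invFun := fun x => ⟨a.1⁻¹ • x.1, by rw [map_smul, x.2]; exact (a⁻¹).2⟩
      left_inv := fun x => Subtype.ext (inv_smul_smul _ _)
      right_inv := fun x => Subtype.ext (smul_inv_smul _ _) }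
  map_one' := by ext x; exact one_smul A x.1
  map_mul' a b := by ext x; exact mul_smul a.1 b.1 x.1

@[simp] theorem fiberHom_apply_coe (y : Y) (a : stabilizer A y) (x : {x // p x = y}) :
    (fiberHom p y a x : Om) = a.1 • x.1 := rfl

/-- The permutation group induced on a fibre by its stabilizer. -/
def fiberGroup (y : Y) : Subgroup (Equiv.Perm {x // p x = y}) := (fiberHom p y).range

/-- The socle of the permutation group induced on a fibre. -/
def fiberSocle (y : Y) : Subgroup (Equiv.Perm {x // p x = y}) := innerSocle (fiberGroup p y)

/-- The bijection of fibres induced by a group element. -/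
def fiberTransport (a : A) {y y' : Y} (h : a • y = y') : {x // p x = y} ≃ {x // p x = y'} where
  toFun x := ⟨a • x.1, by rw [map_smul, x.2, h]⟩
  invFun x := ⟨a⁻¹ • x.1, by rw [map_smul, x.2, ← h, inv_smul_smul]⟩
  left_inv x := Subtype.ext (inv_smul_smul _ _)
  right_inv x := Subtype.ext (smul_inv_smul _ _)

theorem conj_mem_stabilizer {a b : A} {y y' : Y} (h : a • y = y') (hb : b ∈ stabilizer A y) :
    a * b * a⁻¹ ∈ stabilizer A y' := by
  rw [mem_stabilizer_iff] at *
  rw [← h, mul_smul, inv_smul_smul, mul_smul, hb]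

theorem fiberTransport_conj {a : A} {y y' : Y} (h : a • y = y') (b : stabilizer A y) :
    (fiberTransport p a h).permCongrHom (fiberHom p y b) =
      fiberHom p y' ⟨a * b.1 * a⁻¹, conj_mem_stabilizer h b.2⟩ := by
  ext x
  simp [fiberTransport, Equiv.permCongrHom, mul_smul]

theorem fiberGroup_map_transport {a : A} {y y' : Y} (h : a • y = y') :
    (fiberGroup p y).map ((fiberTransport p a h).permCongrHom : _ →* _) = fiberGroup p y' := by
  ext σ
  constructor
  · rintro ⟨_, ⟨b, rfl⟩, rfl⟩
    exact ⟨_, (fiberTransport_conj p h b).symm⟩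
  · rintro ⟨b, rfl⟩
    have h' : a⁻¹ • y' = y := by rw [← h, inv_smul_smul]
    refine ⟨_, ⟨⟨a⁻¹ * b.1 * a, ?_⟩, rfl⟩, (fiberTransport_conj p h _).trans ?_⟩
    · simpa using conj_mem_stabilizer h' b.2
    · congr 1
      ext
      simp [mul_assoc]

theorem fiberSocle_map_transport {a : A} {y y' : Y} (h : a • y = y') :
    (fiberSocle p y).map ((fiberTransport p a h).permCongrHom : _ →* _) = fiberSocle p y' := by
  rw [fiberSocle, fiberSocle, ← fiberGroup_map_transport p h, innerSocle_map]

/-- The image of a subgroup in the permutations of a fibre. -/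
def fiberImage (X : Subgroup A) (y : Y) : Subgroup (Equiv.Perm {x // p x = y}) :=
  (X.subgroupOf (stabilizer A y)).map (fiberHom p y)

theorem fiberImage_le (X : Subgroup A) (y : Y) : fiberImage p X y ≤ fiberGroup p y := by
  rintro _ ⟨a, -, rfl⟩
  exact ⟨a, rfl⟩

/-- The elements that fix the base pointwise and act on each fibre by an element of the socle. -/
def socleKernel : Subgroup A :=
  ⨅ y, ((fiberSocle p y).comap (fiberHom p y)).map (stabilizer A y).subtype

theorem mem_socleKernel {a : A} : a ∈ socleKernel p ↔
    ∀ y, ∃ h : a ∈ stabilizer A y, fiberHom p y ⟨a, h⟩ ∈ fiberSocle p y := by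
  simp only [socleKernel, Subgroup.mem_iInf, Subgroup.mem_map, Subgroup.mem_comap]
  refine forall_congr' fun y => ⟨?_, ?_⟩
  · rintro ⟨b, hb, rfl⟩
    exact ⟨b.2, hb⟩
  · rintro ⟨h, hb⟩
    exact ⟨⟨a, h⟩, hb, rfl⟩

instance socleKernel_normal : (socleKernel p).Normal := by
  refine ⟨fun m hm a => ?_⟩
  rw [mem_socleKernel] at *
  intro y
  obtain ⟨h1, h2⟩ := hm (a⁻¹ • y)
  have h : a • a⁻¹ • y = y := smul_inv_smul a y
  refine ⟨conj_mem_stabilizer h h1, ?_⟩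
  rw [← fiberSocle_map_transport p h, ← fiberTransport_conj p h ⟨m, h1⟩]
  exact Subgroup.mem_map_of_mem _ h2

/-- The projection of `socleKernel` to the socle on a fibre. -/
def socleProj (y : Y) : socleKernel p →* fiberSocle p y where
  toFun m := ⟨fiberHom p y ⟨m.1, ((mem_socleKernel p).1 m.2 y).1⟩,
    ((mem_socleKernel p).1 m.2 y).2⟩
  map_one' := Subtype.ext (map_one (fiberHom p y))
  map_mul' a b := Subtype.ext (map_mul (fiberHom p y)
    ⟨a.1, ((mem_socleKernel p).1 a.2 y).1⟩ ⟨b.1, ((mem_socleKernel p).1 b.2 y).1⟩)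

theorem fiberHom_eq_one_iff {y : Y} {a : stabilizer A y} :
    fiberHom p y a = 1 ↔ ∀ x, p x = y → a.1 • x = x :=
  ⟨fun h x hx => congrArg Subtype.val (DFunLike.congr_fun h (⟨x, hx⟩ : {x // p x = y})),
    fun h => Equiv.ext fun x => Subtype.ext (h x.1 x.2)⟩

theorem socleProj_eq_one_iff {y : Y} {m : socleKernel p} :
    socleProj p y m = 1 ↔ ∀ x, p x = y → m.1 • x = x :=
  Subtype.ext_iff.trans (fiberHom_eq_one_iff p)

theorem socleKernel_smul {m : A} (hm : m ∈ socleKernel p) (y : Y) : m • y = y :=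
  ((mem_socleKernel p).1 hm y).1

/-- The subgroups above a point stabilizer are comparable with the stabilizer of its image. -/
theorem eq_or_stabilizer_le [IsPretransitive A Om]
    (hprim : ∀ x : Om, stabilizer A x ⋖ stabilizer A (p x))
    (hM : ∃ m ∈ socleKernel p, ∃ x : Om, m • x ≠ x)
    (hl : ∀ l : (∀ y, fiberSocle p y), ∃ m, ∀ y, socleProj p y m = l y)
    (x : Om) (H : Subgroup A) (hx : stabilizer A x ≤ H) :
    H = stabilizer A x ∨ stabilizer A (p x) ≤ H := by
  classical
  by_cases hH : H ≤ stabilizer A (p x)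
  · exact ((hprim x).eq_or_eq hx hH).imp id fun h => h.ge
  right
  obtain ⟨h, hhH, hhx⟩ := SetLike.not_le_iff_exists.1 hH
  rw [mem_stabilizer_iff] at hhx
  -- Given `m`, take `m1` agreeing with `m` on the fibre of `x` and trivial on all others. Then
  -- `m1⁻¹ * m` fixes `x`, and so does `h⁻¹ * m1 * h`, since `h` carries the fibre of `x` to a
  -- different one. Both lie in `H`, hence so does `m`.
  have hMH : socleKernel p ≤ H := by
    intro m hm
    obtain ⟨m1, hm1⟩ := hl (Pi.mulSingle (p x) (socleProj p (p x) ⟨m, hm⟩))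
    have e1 : m1.1⁻¹ * m ∈ H := by
      refine hx ?_
      have : socleProj p (p x) (m1⁻¹ * ⟨m, hm⟩) = 1 := by
        rw [map_mul, map_inv, hm1, Pi.mulSingle_eq_same, inv_mul_cancel]
      exact (socleProj_eq_one_iff p).1 this x rfl
    have e2 : h⁻¹ * m1.1 * h ∈ H := by
      refine hx ?_
      have : socleProj p (h • p x) m1 = 1 := by
        rw [hm1, Pi.mulSingle_eq_of_ne hhx]
      have := (socleProj_eq_one_iff p).1 this (h • x) (map_smul p h x)
      rw [mem_stabilizer_iff, mul_smul, mul_smul, this, inv_smul_smul]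
    have e3 : m1.1 ∈ H := by
      have := H.mul_mem (H.mul_mem hhH e2) (H.inv_mem hhH)
      simpa [mul_assoc] using this
    simpa using H.mul_mem e3 e1
  have hM1 : socleKernel p ≤ stabilizer A (p x) := fun m hm => socleKernel_smul p hm _
  -- By maximality `socleKernel p` and the stabilizer of `x` generate the stabilizer of `p x`;
  -- otherwise `socleKernel p` would fix `x`, and by normality and transitivity every point.
  rcases (hprim x).eq_or_eq (c := socleKernel p ⊔ stabilizer A x) le_sup_right
    (sup_le hM1 (hprim x).le) with h1 | h1
  · exfalso
    obtain ⟨m, hm, z, hz⟩ := hM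
    obtain ⟨a, rfl⟩ := exists_smul_eq A x z
    have : a⁻¹ * m * a ∈ socleKernel p := by
      simpa using (socleKernel_normal p).conj_mem m hm a⁻¹
    have := h1.le (Subgroup.mem_sup_left this)
    rw [mem_stabilizer_iff, mul_smul, mul_smul, inv_smul_eq_iff] at this
    exact hz this
  · rw [← h1]
    exact sup_le hMH hx

/-! ### Steps whose fibre groups are almost simple -/

variable (has : ∀ y, IsNonabelianAlmostSimple (fiberGroup p y))

include has

/-- It is enough that each socle element has one lift normalizing `X`. This weak form allows `X` to
be normalized only by the kernel of the action on the base. -/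
theorem fiberSocle_le_fiberImage {X : Subgroup A} {y : Y}
    (hX : ∀ s ∈ fiberSocle p y, ∃ b : stabilizer A y, fiberHom p y b = s ∧
      ∀ a ∈ X, b * a * b⁻¹ ∈ X) (h1 : fiberImage p X y ≠ ⊥) :
    fiberSocle p y ≤ fiberImage p X y := by
  refine innerSocle_le_of_normalized (has y) (fiberImage_le p X y) h1 ?_
  rintro s hs _ ⟨a, ha, rfl⟩
  obtain ⟨b, rfl, hb⟩ := hX s hs
  exact ⟨b * a * b⁻¹, hb a ha, by simp⟩

theorem fiberSocle_le_fiberImage_of_normal {X : Subgroup A} (hX : X.Normal) {y : Y}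
    (h1 : fiberImage p X y ≠ ⊥) : fiberSocle p y ≤ fiberImage p X y := by
  refine fiberSocle_le_fiberImage p has (fun s hs => ?_) h1
  obtain ⟨b, rfl⟩ := innerSocle_le hs
  exact ⟨b, rfl, fun a ha => hX.conj_mem a ha b⟩

theorem fiberSocle_ne_bot (y : Y) : fiberSocle p y ≠ ⊥ := innerSocle_ne_bot (has y)

/-- Among the subgroups of the kernel `N` on the base that are normalized by `N` and act
nontrivially, one with smallest permutation image already acts on every fibre through the socle:
cutting it down to the socle on one fibre stays in this class, so cannot shrink the image. -/
theorem exists_mem_socleKernel_smul_ne [Finite Om]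
    (hN : ∃ a : A, (∀ y : Y, a • y = y) ∧ ∃ x : Om, a • x ≠ x) :
    ∃ m ∈ socleKernel p, ∃ x : Om, m • x ≠ x := by
  let N : Subgroup A := (toPermHom A Y).ker
  have memN : ∀ a, a ∈ N ↔ ∀ y : Y, a • y = y := fun a => Equiv.ext_iff
  -- `A` may be infinite, so size is measured by the finite image in the permutations of `Om`.
  let f : Subgroup A → ℕ := fun X => Nat.card (X.map (toPermHom A Om))
  let C : Set (Subgroup A) := {X | X ≤ N ∧ (∀ n ∈ N, ∀ x ∈ X, n * x * n⁻¹ ∈ X) ∧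
    ∃ a ∈ X, ∃ x : Om, a • x ≠ x}
  have hC : C.Nonempty := by
    obtain ⟨a, ha, hx⟩ := hN
    exact ⟨N, le_rfl, fun n hn x hx => N.mul_mem (N.mul_mem hn hx) (N.inv_mem hn),
      a, (memN a).2 ha, hx⟩
  obtain ⟨X, ⟨hXN, hXn, b, hbX, x0, hx0⟩, hmin⟩ := (measure f).wf.has_min C hC
  have hS : ∀ y, fiberImage p X y ≠ ⊥ → fiberSocle p y ≤ fiberImage p X y := fun y hy => by
    have hy' : fiberImage p N y ≠ ⊥ := fun h => hy <| by
      rw [eq_bot_iff, ← h]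
      rintro _ ⟨a, ha, rfl⟩
      exact ⟨a, hXN ha, rfl⟩
    refine fiberSocle_le_fiberImage p has (fun s hs => ?_) hy
    obtain ⟨n, hn, rfl⟩ := fiberSocle_le_fiberImage_of_normal p has inferInstance hy' hs
    exact ⟨n, rfl, fun a ha => hXn n hn a ha⟩
  refine ⟨b, (mem_socleKernel p).2 fun y => ⟨(memN b).1 (hXN hbX) y, ?_⟩, x0, hx0⟩
  by_cases hy : fiberImage p X y = ⊥
  · have : fiberHom p y ⟨b, (memN b).1 (hXN hbX) y⟩ ∈ fiberImage p X y := ⟨_, hbX, rfl⟩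
    rw [hy, Subgroup.mem_bot] at this
    rw [this]
    exact one_mem _
  let X' : Subgroup A := X ⊓ ((fiberSocle p y).comap (fiberHom p y)).map (stabilizer A y).subtype
  have memX' : ∀ a, a ∈ X' ↔ a ∈ X ∧ ∃ h : a ∈ stabilizer A y,
      fiberHom p y ⟨a, h⟩ ∈ fiberSocle p y := fun a =>
    and_congr_right fun _ => ⟨fun ⟨c, hc, h⟩ => h ▸ ⟨c.2, hc⟩, fun ⟨h, hc⟩ => ⟨⟨a, h⟩, hc, rfl⟩⟩
  have hX' : X' ∈ C := by
    refine ⟨inf_le_left.trans hXN, fun n hn x hx => ?_, ?_⟩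
    · obtain ⟨h1, h2, h3⟩ := (memX' x).1 hx
      have h4 : n ∈ stabilizer A y := (memN n).1 hn y
      refine (memX' _).2 ⟨hXn n hn x h1, ?_, ?_⟩
      · exact mul_mem (mul_mem h4 h2) (inv_mem h4)
      · have := conj_mem_innerSocle (has y) (g := fiberHom p y ⟨n, h4⟩) ⟨_, rfl⟩ h3
        rw [← map_inv, ← map_mul, ← map_mul] at this
        exact this
    · obtain ⟨⟨s, hs⟩, hs1⟩ := Subgroup.ne_bot_iff_exists_ne_one.1 (fiberSocle_ne_bot p has y)
      obtain ⟨a, ha, rfl⟩ := hS y hy hs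
      refine ⟨a, (memX' _).2 ⟨ha, a.2, hs⟩, ?_⟩
      by_contra! h
      exact hs1 (Subtype.ext ((fiberHom_eq_one_iff p).2 fun x _ => h x))
  have hle : X'.map (toPermHom A Om) ≤ X.map (toPermHom A Om) := Subgroup.map_mono inf_le_left
  have heq : X'.map (toPermHom A Om) = X.map (toPermHom A Om) :=
    Subgroup.eq_of_le_of_card_ge hle (not_lt.1 (hmin X' hX'))
  obtain ⟨c, hc, hcb⟩ : toPermHom A Om b ∈ X'.map (toPermHom A Om) :=
    heq ▸ Subgroup.mem_map_of_mem _ hbX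
  obtain ⟨-, h2, h3⟩ := (memX' c).1 hc
  convert h3 using 1
  exact Equiv.ext fun x => Subtype.ext (DFunLike.congr_fun hcb x.1).symm

theorem socleProj_surjective [Finite Om] [IsPretransitive A Y]
    (hN : ∃ a : A, (∀ y : Y, a • y = y) ∧ ∃ x : Om, a • x ≠ x) (y : Y) :
    Function.Surjective (socleProj p y) := by
  obtain ⟨m, hm, x, hx⟩ := exists_mem_socleKernel_smul_ne p has hN
  obtain ⟨a, ha⟩ := exists_smul_eq A (p x) y
  have hm' : a * m * a⁻¹ ∈ socleKernel p := (socleKernel_normal p).conj_mem m hm a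
  have hne : fiberImage p (socleKernel p) y ≠ ⊥ := by
    intro h
    have : fiberHom p y ⟨a * m * a⁻¹, socleKernel_smul p hm' y⟩ ∈
      fiberImage p (socleKernel p) y := ⟨_, hm', rfl⟩
    rw [h, Subgroup.mem_bot, fiberHom_eq_one_iff] at this
    have := this (a • x) (by rw [map_smul, ha])
    simp only [mul_smul, inv_smul_smul, smul_left_cancel_iff] at this
    exact hx this
  rintro ⟨s, hs⟩
  obtain ⟨b, hb, rfl⟩ := fiberSocle_le_fiberImage_of_normal p has inferInstance hne hs
  exact ⟨⟨b, hb⟩, rfl⟩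

/-- If distinct points are separated by the kernels of the projections, then `socleKernel` is the
full product of the socles. -/
theorem exists_forall_socleProj_eq [Finite Om] [Finite Y] [IsPretransitive A Y]
    (hN : ∃ a : A, (∀ y : Y, a • y = y) ∧ ∃ x : Om, a • x ≠ x)
    (hR : ∀ y y', (socleProj p y).ker = (socleProj p y').ker → y = y')
    (l : ∀ y, fiberSocle p y) : ∃ m, ∀ y, socleProj p y m = l y :=
  have : ∀ y, IsSimpleGroup (fiberSocle p y) := fun y => isSimpleGroup_innerSocle (has y)
  exists_forall_eq_of_ker_injective (socleProj p) (socleProj_surjective p has hN)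
    (fun y => innerSocle_noncomm (has y)) hR l

/-- Equality of kernels is an `A`-invariant equivalence relation. By `hH` a nontrivial class
contains a whole fibre of `q`, so there triviality of an element of `socleKernel p` on one fibre of
`p` forces triviality on the others; `hK` supplies an element contradicting this. -/
theorem eq_of_ker_socleProj_eq [Finite Om] [IsPretransitive A Y]
    {Z : Type w} [MulAction A Z] (q : Y →[A] Z)
    (hN : ∃ a : A, (∀ y : Y, a • y = y) ∧ ∃ x : Om, a • x ≠ x)
    (hH : ∀ (y : Y) (H : Subgroup A), stabilizer A y ≤ H →
      H = stabilizer A y ∨ stabilizer A (q y) ≤ H)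
    (hK : ∃ (y : Y) (a : A), (∀ y', q y' = q y → a • y' = y') ∧
      (∀ x, p x = y → a • x = x) ∧ ∃ x, q (p x) = q y ∧ a • x ≠ x)
    (y y' : Y) (h : (socleProj p y).ker = (socleProj p y').ker) : y = y' := by
  by_contra hne
  have hR : ∀ {y y' : Y}, (socleProj p y).ker = (socleProj p y').ker ↔
      ∀ m ∈ socleKernel p, (∀ x, p x = y → m • x = x) ↔ ∀ x, p x = y' → m • x = x := by
    intro y y'
    rw [SetLike.ext_iff]
    simp only [MonoidHom.mem_ker, socleProj_eq_one_iff, Subtype.forall]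
  have hRsmul : ∀ (a : A) {y y' : Y}, (socleProj p y).ker = (socleProj p y').ker →
      (socleProj p (a • y)).ker = (socleProj p (a • y')).ker := by
    intro a y y' h
    have key : ∀ (y : Y) (m : A), (∀ x, p x = a • y → m • x = x) ↔
        ∀ x, p x = y → (a⁻¹ * m * a) • x = x := by
      refine fun y m => ⟨fun h x hx => ?_, fun h x hx => ?_⟩
      · rw [mul_smul, mul_smul, h _ (by rw [map_smul, hx]), inv_smul_smul]
      · have := h (a⁻¹ • x) (by rw [map_smul, hx, inv_smul_smul])
        rwa [mul_smul, smul_inv_smul, mul_smul, smul_left_cancel_iff] at this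
    rw [hR] at h ⊢
    intro m hm
    rw [key, key]
    refine h _ ?_
    simpa using (socleKernel_normal p).conj_mem m hm a⁻¹
  obtain ⟨y0, a, ha1, ha2, x0, hx0, hax0⟩ := hK
  obtain ⟨b, hb⟩ := exists_smul_eq A y y0
  -- The setwise stabilizer of the class of `y0`; it exceeds the stabilizer of `y0` because `b`
  -- carries the pair `y ≠ y'` to a pair containing `y0`.
  let H : Subgroup A :=
    { carrier := {c | (socleProj p (c • y0)).ker = (socleProj p y0).ker}
      one_mem' := by rw [Set.mem_ofPred_eq, one_smul]
      mul_mem' := fun {c d} hc hd => by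
        rw [Set.mem_ofPred_eq, mul_smul]
        exact (hRsmul c hd).trans hc
      inv_mem' := fun {c} hc => by
        have := hRsmul c⁻¹ hc
        rw [inv_smul_smul] at this
        exact this.symm }
  have hH0 : stabilizer A y0 ≤ H := fun c hc => by
    change (socleProj p (c • y0)).ker = _
    rw [mem_stabilizer_iff.1 hc]
  have hHne : H ≠ stabilizer A y0 := by
    intro heq
    obtain ⟨c, hc⟩ := exists_smul_eq A y0 (b • y')
    have : c ∈ H := by
      change (socleProj p (c • y0)).ker = _
      rw [hc, ← hb]
      exact hRsmul b h.symm
    rw [heq, mem_stabilizer_iff, hc, ← hb, smul_left_cancel_iff] at this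
    exact hne this.symm
  have hHq := (hH y0 H hH0).resolve_left hHne
  have hRq : ∀ y, q y = q y0 → (socleProj p y).ker = (socleProj p y0).ker := by
    intro y hy
    obtain ⟨c, rfl⟩ := exists_smul_eq A y0 y
    exact hHq (by rw [mem_stabilizer_iff, ← map_smul, hy])
  have hay : a ∈ stabilizer A (p x0) := ha1 _ hx0
  have h1 : fiberHom p (p x0) ⟨a, hay⟩ = 1 := by
    -- For `m` in `socleKernel p` lifting `s`, the commutator of `a` and `m` is trivial over `y0`,
    -- where `a` is, hence also over `p x0`. So `a` centralizes the socle there and acts trivially,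
    -- although it moves `x0`.
    refine eq_one_of_commute_innerSocle (has (p x0)) ⟨_, rfl⟩ fun s hs => ?_
    obtain ⟨⟨m, hm⟩, hms⟩ := socleProj_surjective p has hN (p x0) ⟨s, hs⟩
    have hms : fiberHom p (p x0) ⟨m, socleKernel_smul p hm _⟩ = s := congrArg Subtype.val hms
    have hc : a * m * a⁻¹ * m⁻¹ ∈ socleKernel p :=
      mul_mem ((socleKernel_normal p).conj_mem m hm a) (inv_mem hm)
    have hc0 : ∀ x, p x = y0 → (a * m * a⁻¹ * m⁻¹) • x = x := by
      intro x hx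
      have e1 : a⁻¹ • m⁻¹ • x = m⁻¹ • x := by
        rw [inv_smul_eq_iff, ha2]
        rw [map_smul, hx, socleKernel_smul p (inv_mem hm)]
      rw [mul_smul, mul_smul, mul_smul, e1, smul_inv_smul, ha2 x hx]
    have hc1 := (hR.1 (hRq _ hx0) _ hc).2 hc0
    have hc2 := (fiberHom_eq_one_iff p (a := ⟨_, socleKernel_smul p hc (p x0)⟩)).2 hc1
    have hc3 : fiberHom p (p x0) ⟨a, hay⟩ * s * (fiberHom p (p x0) ⟨a, hay⟩)⁻¹ * s⁻¹ = 1 := by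
      rw [← hms, ← map_inv, ← map_inv, ← map_mul, ← map_mul, ← map_mul]
      exact hc2
    rwa [mul_inv_eq_one, mul_inv_eq_iff_eq_mul] at hc3
  exact hax0 ((fiberHom_eq_one_iff p).1 h1 x0 rfl)

end Step

/-! ### The kernel of a wreath product -/

section WreathKernel

variable {I J : Type u} (U : Subgroup (Equiv.Perm I)) (V : Subgroup (Equiv.Perm J))

/-- The projection of a wreath product to the group permuting the branches. -/
noncomputable def wreathBase [Nonempty I] : wreathProduct U V →* V :=
  -- The chosen permutation of the branches is read off from second coordinates. Since `I` is
  -- nonempty this determines it, whence multiplicativity.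
  have key : ∀ σ : wreathProduct U V, ∀ j i, (σ.1 (i, j)).2 = σ.2.choose j := fun σ j i => by
    rw [σ.2.choose_spec.2.choose_spec.2]
  { toFun := fun σ => ⟨σ.2.choose, σ.2.choose_spec.1⟩
    map_one' := Subtype.ext <| Equiv.ext fun j => (key 1 j (Classical.arbitrary I)).symm
    map_mul' := fun σ τ => Subtype.ext <| Equiv.ext fun j => by
      have h1 := key (σ * τ) j (Classical.arbitrary I)
      have h2 := key σ (τ.1 (Classical.arbitrary I, j)).2 (τ.1 (Classical.arbitrary I, j)).1
      exact h1.symm.trans (h2.trans (congrArg σ.2.choose (key τ j _))) }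

theorem wreathBase_apply [Nonempty I] (σ : wreathProduct U V) (i : I) (j : J) :
    (wreathBase U V σ).1 j = (σ.1 (i, j)).2 := by
  rw [σ.2.choose_spec.2.choose_spec.2]
  rfl

theorem wreathBase_surjective [Nonempty I] : Function.Surjective (wreathBase U V) := by
  rintro ⟨v, hv⟩
  refine ⟨⟨Equiv.prodCongr (Equiv.refl I) v, v, hv, 1, fun _ => U.one_mem, fun _ _ => rfl⟩, ?_⟩
  refine Subtype.ext <| Equiv.ext fun j => ?_
  rw [wreathBase_apply U V _ (Classical.arbitrary I)]
  rfl

/-- The kernel of the projection of a wreath product is a direct power. -/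
noncomputable def wreathKernelEquiv [Nonempty I] : (J → U) ≃* (wreathBase U V).ker := by
  let f : (J → U) →* (wreathBase U V).ker :=
    { toFun := fun w => ⟨⟨Equiv.prodCongrLeft fun j => (w j).1, 1, V.one_mem,
          fun j => (w j).1, fun j => (w j).2, fun _ _ => rfl⟩, by
        refine Subtype.ext <| Equiv.ext fun j => ?_
        rw [wreathBase_apply U V _ (Classical.arbitrary I)]
        rfl⟩
      map_one' := rfl
      map_mul' := fun _ _ => rfl }
  refine MulEquiv.ofBijective f ⟨fun w w' h => ?_, ?_⟩
  · refine funext fun j => Subtype.ext <| Equiv.ext fun i => ?_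
    have := congrArg (fun σ : (wreathBase U V).ker => (σ.1.1 (i, j)).1) h
    exact this
  · rintro ⟨⟨σ, hσ⟩, hk⟩
    obtain ⟨v, hv, w, hw, h⟩ := id hσ
    refine ⟨fun j => ⟨w j, hw j⟩, Subtype.ext <| Subtype.ext <| Equiv.ext fun ⟨i, j⟩ => ?_⟩
    have h1 := wreathBase_apply U V ⟨σ, hσ⟩ i j
    rw [MonoidHom.mem_ker.1 hk] at h1
    exact Prod.ext (by rw [h]; rfl) h1

end WreathKernel

/-! ### Composition factors of one step -/

section StepFactors

variable {A : Type v} {Om : Type u} {Y : Type u} [Group A] [MulAction A Om] [MulAction A Y]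
  (p : Om →[A] Y)

theorem ker_toPermHom_le (hp : Function.Surjective p) :
    (toPermHom A Om).ker ≤ (toPermHom A Y).ker := by
  intro a ha
  refine MonoidHom.mem_ker.2 <| Equiv.ext fun y => ?_
  obtain ⟨x, rfl⟩ := hp y
  exact (map_smul p a x).symm.trans
    (congrArg p (DFunLike.congr_fun (MonoidHom.mem_ker.1 ha) x))

/-- The map of permutation groups induced by a surjective equivariant map. -/
noncomputable def rangeMap (hp : Function.Surjective p) :
    (toPermHom A Om).range →* (toPermHom A Y).range :=
  (toPermHom A Om).rangeRestrict.liftOfSurjective (toPermHom A Om).rangeRestrict_surjective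
    ⟨(toPermHom A Y).rangeRestrict, by
      rw [MonoidHom.ker_rangeRestrict, MonoidHom.ker_rangeRestrict]
      exact ker_toPermHom_le p hp⟩

theorem rangeMap_apply (hp : Function.Surjective p) (a : A) :
    rangeMap p hp ((toPermHom A Om).rangeRestrict a) = (toPermHom A Y).rangeRestrict a :=
  MonoidHom.liftOfRightInverse_comp_apply _ _ _ _ _

theorem rangeMap_surjective (hp : Function.Surjective p) : Function.Surjective (rangeMap p hp) := by
  intro y
  obtain ⟨a, rfl⟩ := (toPermHom A Y).rangeRestrict_surjective y
  exact ⟨_, rangeMap_apply p hp a⟩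

/-- The action of `socleKernel` in the kernel of `rangeMap`. -/
noncomputable def socleKernelAction (hp : Function.Surjective p) :
    socleKernel p →* (rangeMap p hp).ker :=
  ((toPermHom A Om).rangeRestrict.comp (socleKernel p).subtype).codRestrict _ fun m => by
    rw [MonoidHom.mem_ker, MonoidHom.comp_apply, rangeMap_apply]
    exact Subtype.ext <| Equiv.ext fun y => socleKernel_smul p m.2 y

theorem socleKernelAction_eq_one_iff (hp : Function.Surjective p) (m : socleKernel p) :
    socleKernelAction p hp m = 1 ↔ ∀ x : Om, m.1 • x = x := by
  rw [Subtype.ext_iff, Subtype.ext_iff, Equiv.ext_iff]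
  rfl

instance normal_range_socleKernelAction (hp : Function.Surjective p) :
    (socleKernelAction p hp).range.Normal := by
  refine ⟨?_⟩
  rintro _ ⟨⟨m, hm⟩, rfl⟩ ⟨⟨_, a, rfl⟩, ha⟩
  exact ⟨⟨a * m * a⁻¹, (socleKernel_normal p).conj_mem m hm a⟩,
    Subtype.ext <| Subtype.ext <| by
      change toPermHom A Om (a * m * a⁻¹) = _
      rw [map_mul, map_mul, map_inv]
      rfl⟩

/-- Acting on `Om` and projecting to all the fibre socles have the same kernel, because the fibres
cover `Om`; the images are therefore isomorphic quotients of `socleKernel p`. -/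
theorem nonempty_range_socleKernelAction_equiv (hp : Function.Surjective p)
    (hl : ∀ l : (∀ y, fiberSocle p y), ∃ m, ∀ y, socleProj p y m = l y) :
    Nonempty ((socleKernelAction p hp).range ≃* ∀ y, fiberSocle p y) := by
  let π : socleKernel p →* ∀ y, fiberSocle p y := MonoidHom.pi (socleProj p)
  have hπ : Function.Surjective π := fun l => by
    obtain ⟨m, hm⟩ := hl l
    exact ⟨m, funext hm⟩
  have hk : (socleKernelAction p hp).ker = π.ker := by
    ext m
    rw [MonoidHom.mem_ker, MonoidHom.mem_ker, socleKernelAction_eq_one_iff, funext_iff]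
    exact ⟨fun h y => (socleProj_eq_one_iff p).2 fun x _ => h x,
      fun h x => (socleProj_eq_one_iff p).1 (h (p x)) x rfl⟩
  exact ⟨(QuotientGroup.quotientKerEquivRange (socleKernelAction p hp)).symm.trans
    ((QuotientGroup.quotientMulEquivOfEq hk).trans
      (QuotientGroup.quotientKerEquivOfSurjective π hπ))⟩

/-- The normal subgroup of the kernel of `rangeMap` coming from `socleKernel p` is a product of
socles indexed by `Y`, which matches the wreath kernel `J → U`. -/
theorem factorsContain_wreathProduct [Finite Om] (hp : Function.Surjective p)
    (hl : ∀ l : (∀ y, fiberSocle p y), ∃ m, ∀ y, socleProj p y m = l y)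
    {I J : Type u} [Nonempty I] (U : Subgroup (Equiv.Perm I)) (V : Subgroup (Equiv.Perm J))
    (e : J ≃ Y) (hU : ∀ y, Nonempty (U ≃* fiberSocle p y))
    (hV : FactorsContain (toPermHom A Y).range V) :
    FactorsContain (toPermHom A Om).range (wreathProduct U V) := by
  refine hV.extension (rangeMap p hp) (rangeMap_surjective p hp) (wreathBase U V)
    (wreathBase_surjective U V) ?_
  obtain ⟨c⟩ := nonempty_range_socleKernelAction_equiv p hp hl
  refine (FactorsContain.of_normal (socleKernelAction p hp).range).of_mulEquiv (.refl _)
    (c.trans (MulEquiv.trans ?_ (wreathKernelEquiv U V)))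
  have d := fun y => Classical.choice (hU y)
  exact (MulEquiv.piCongrRight d).symm.trans (MulEquiv.arrowCongr e.symm (.refl U))

end StepFactors

/-! ### Towers of permutation representations -/

section Tower

variable {A : Type v} [Group A] {r : ℕ} (P : Fin (r + 1) → Type u) [∀ i, MulAction A (P i)]
  (res : ∀ {i j : Fin (r + 1)}, i ≤ j → (P j →[A] P i))
  (res_refl : ∀ {i : Fin (r + 1)} (x : P i), res le_rfl x = x)
  (res_res : ∀ {i j k : Fin (r + 1)} (h : i ≤ j) (h' : j ≤ k) (x : P k),
    res h (res h' x) = res (h.trans h') x)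
  (has : ∀ (i : Fin r) (y : P i.castSucc),
    IsNonabelianAlmostSimple (fiberGroup (res i.castSucc_le_succ) y))
  (hN : ∀ i : Fin r, ∃ a : A, (∀ y : P i.castSucc, a • y = y) ∧ ∃ x : P i.succ, a • x ≠ x)
  (hK : ∀ (z : Fin (r + 1)) (i : Fin r) (h : z ⋖ i.castSucc), ∃ (y : P i.castSucc) (a : A),
    (∀ y', res h.le y' = res h.le y → a • y' = y') ∧
    (∀ x, res i.castSucc_le_succ x = y → a • x = x) ∧
    ∃ x, res h.le (res i.castSucc_le_succ x) = res h.le y ∧ a • x ≠ x)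
  [∀ i, Finite (P i)] [∀ i, IsPretransitive A (P i)] [Subsingleton (P 0)]

-- The hypothesis `ih` on overgroups one level below feeds `eq_of_ker_socleProj_eq`: an overgroup
-- that is not the stabilizer itself stabilizes an image at or below the preceding level. At the
-- bottom level the base is a point and there is nothing to separate.
include res_refl res_res has hN hK in
theorem tower_full_product (i : Fin r)
    (ih : ∀ (y : P i.castSucc) (H : Subgroup A), stabilizer A y ≤ H →
      ∃ (j : Fin (r + 1)) (h : j ≤ i.castSucc), H = stabilizer A (res h y))
    (l : ∀ y, fiberSocle (res i.castSucc_le_succ) y) :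
    ∃ m, ∀ y, socleProj (res i.castSucc_le_succ) y m = l y := by
  refine exists_forall_socleProj_eq _ (has i) (hN i) (fun y y' hy => ?_) l
  by_cases hi : IsMin i.castSucc
  · have h0 : i.castSucc = 0 := hi.eq_bot
    have : Subsingleton (P i.castSucc) := h0 ▸ inferInstance
    exact Subsingleton.elim y y'
  · have hz : Order.pred i.castSucc ⋖ i.castSucc := Order.pred_covBy_of_not_isMin hi
    refine eq_of_ker_socleProj_eq _ (has i) (res hz.le) (hN i) (fun y H hH => ?_)
      (hK _ i hz) y y' hy
    obtain ⟨j, h, rfl⟩ := ih y H hH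
    rcases h.eq_or_lt with rfl | hlt
    · exact .inl (by rw [res_refl])
    · right
      have h' : j ≤ Order.pred i.castSucc := Order.le_pred_of_lt hlt
      intro a ha
      rw [mem_stabilizer_iff] at ha ⊢
      rw [← res_res h' hz.le, ← map_smul, ha]

variable (hprim : ∀ (i : Fin r) (x : P i.succ),
  stabilizer A x ⋖ stabilizer A (res i.castSucc_le_succ x))

include res_refl res_res has hN hK hprim

/-- The only groups above a point stabilizer are the stabilizers of the images of the point. -/
theorem tower_stabilizers (i : Fin (r + 1)) :
    ∀ (y : P i) (H : Subgroup A), stabilizer A y ≤ H →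
      ∃ (j : Fin (r + 1)) (h : j ≤ i), H = stabilizer A (res h y) := by
  induction i using Fin.induction with
  | zero =>
    intro y H hH
    refine ⟨0, le_rfl, ?_⟩
    have : stabilizer A y = ⊤ := top_le_iff.1 fun a _ => Subsingleton.elim _ _
    rw [res_refl, this]
    rw [this] at hH
    exact top_le_iff.1 hH
  | succ i ih =>
    intro x H hH
    rcases eq_or_stabilizer_le (res i.castSucc_le_succ) (hprim i)
      (exists_mem_socleKernel_smul_ne _ (has i) (hN i))
      (tower_full_product P res res_refl res_res has hN hK i ih) x H hH with h | h
    · exact ⟨i.succ, le_rfl, by rw [res_refl, h]⟩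
    · obtain ⟨j, hj, h⟩ := ih _ H h
      exact ⟨j, hj.trans i.castSucc_le_succ, by rw [h, res_res]⟩

/-- The bijection is carried along in the induction because it matches the number of copies of the
socle in the wreath kernel with the number of points of the level below. -/
theorem tower_factorsContain
    (hsurj : ∀ i : Fin r, Function.Surjective (res i.castSucc_le_succ)) (hne : ∀ i, Nonempty (P i))
    (I : Fin r → Type u) (U : ∀ i, Subgroup (Equiv.Perm (I i)))
    (hI : ∀ (i : Fin r) y, Nonempty (I i ≃ {x // res i.castSucc_le_succ x = y}))
    (hU : ∀ (i : Fin r) y, Nonempty (U i ≃* fiberSocle (res i.castSucc_le_succ) y))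
    (n : ℕ) (hn : n ≤ r) :
    Nonempty (IteratedProd n (fun j => I (j.castLE hn)) ≃ P ⟨n, Nat.lt_succ_of_le hn⟩) ∧
    FactorsContain (toPermHom A (P ⟨n, Nat.lt_succ_of_le hn⟩)).range
      (iteratedWreathProduct n (fun j => I (j.castLE hn)) (fun j => U (j.castLE hn))) := by
  induction n with
  | zero =>
    have h0 : Subsingleton (P ⟨0, Nat.lt_succ_of_le hn⟩) := ‹Subsingleton (P 0)›
    obtain ⟨x⟩ := hne ⟨0, Nat.lt_succ_of_le hn⟩
    have : Subsingleton (iteratedWreathProduct 0 (fun j => I (j.castLE hn))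
        (fun j => U (j.castLE hn))) :=
      ⟨fun a b => Subtype.ext <| Equiv.ext fun _ => @Subsingleton.elim PUnit _ _ _⟩
    exact ⟨⟨⟨fun _ => x, fun _ => PUnit.unit, fun _ => rfl, fun _ => Subsingleton.elim _ _⟩⟩,
      .of_subsingleton _ _⟩
  | succ n ih =>
    obtain ⟨⟨e⟩, hF⟩ := ih (Nat.le_of_succ_le hn)
    let i : Fin r := ⟨n, hn⟩
    have d := fun y => Classical.choice (hI i y)
    have : Nonempty (I i) := by
      obtain ⟨y⟩ := hne i.castSucc
      obtain ⟨x, hx⟩ := hsurj i y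
      exact ⟨(d y).symm ⟨x, hx⟩⟩
    refine ⟨⟨?_⟩, ?_⟩
    · exact (Equiv.prodComm _ _).trans <| (Equiv.prodCongrLeft fun _ => e).trans <|
        (Equiv.sigmaEquivProd _ _).symm.trans <| (Equiv.sigmaCongrRight d).trans <|
        Equiv.sigmaFiberEquiv _
    · exact factorsContain_wreathProduct (res i.castSucc_le_succ) (hsurj i)
        (tower_full_product P res res_refl res_res has hN hK i
          (tower_stabilizers P res res_refl res_res has hN hK hprim i.castSucc)) (U i) _ e (hU i) hF

end Tower

/-! ### Points of a field extension in an algebraic closure -/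

section Embeddings

variable {B C L L' : Type u} [Field B] [Field C] [Field L] [Field L'] [IsAlgClosed L]
  [IsAlgClosed L']

theorem exists_ringEquiv_of_isIntegral (z : B →+* L) (z' : B →+* L') (hz : z.IsIntegral)
    (hz' : z'.IsIntegral) : ∃ θ : L ≃+* L', ∀ b, θ (z b) = z' b := by
  let := z.toAlgebra
  let := z'.toAlgebra
  have : Algebra.IsIntegral B L := ⟨hz⟩
  have : Algebra.IsIntegral B L' := ⟨hz'⟩
  have : IsAlgClosure B L := ⟨inferInstance, inferInstance⟩
  have : IsAlgClosure B L' := ⟨inferInstance, inferInstance⟩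
  exact ⟨(IsAlgClosure.equiv B L L').toRingEquiv, (IsAlgClosure.equiv B L L').commutes⟩

theorem exists_comp_eq_of_isIntegral (g : B →+* C) (hg : g.IsIntegral) (z : B →+* L) :
    ∃ x : C →+* L, x.comp g = z := by
  let := g.toAlgebra
  let := z.toAlgebra
  have : Algebra.IsIntegral B C := ⟨hg⟩
  exact ⟨(IsAlgClosed.lift : C →ₐ[B] L).toRingHom, (IsAlgClosed.lift : C →ₐ[B] L).comp_algebraMap⟩

end Embeddings

section Points

variable {k B C : Type u} [Field k] [Field B] [Field C]

/-- The embeddings over `k` of an extension of `k` into the algebraic closure of `k`. -/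
def FieldPoints (f : k →+* B) : Type u :=
  {x : B →+* AlgebraicClosure k // x.comp f = algebraMap k (AlgebraicClosure k)}

noncomputable instance fieldPointsAction (f : k →+* B) : MulAction Gal(AlgebraicClosure k/k) (FieldPoints f) where
  smul σ x := ⟨(σ : AlgebraicClosure k →+* AlgebraicClosure k).comp x.1, by
    rw [RingHom.comp_assoc, x.2]
    exact RingHom.ext σ.commutes⟩
  one_smul _ := rfl
  mul_smul _ _ _ := rfl

theorem FieldPoints.ext {f : k →+* B} {x y : FieldPoints f} (h : ∀ b, x.1 b = y.1 b) : x = y :=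
  Subtype.ext (RingHom.ext h)

theorem FieldPoints.smul_eq_iff {f : k →+* B} {σ : Gal(AlgebraicClosure k/k)} {x y : FieldPoints f} :
    σ • x = y ↔ ∀ b, σ (x.1 b) = y.1 b :=
  ⟨fun h _ => h ▸ rfl, fun h => FieldPoints.ext h⟩

/-- Restriction of embeddings. -/
noncomputable def resPoints {f : k →+* B} {h : k →+* C} (g : B →+* C) (hg : g.comp f = h) :
    FieldPoints h →[Gal(AlgebraicClosure k/k)] FieldPoints f where
  toFun x := ⟨x.1.comp g, by rw [RingHom.comp_assoc, hg, x.2]⟩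
  map_smul' _ _ := rfl

theorem FieldPoints.isIntegral {f : k →+* B} (x : FieldPoints f) : x.1.IsIntegral := by
  refine RingHom.IsIntegral.tower_top f x.1 ?_
  rw [x.2]
  exact Algebra.IsIntegral.isIntegral

instance fieldPoints_isPretransitive (f : k →+* B) :
    IsPretransitive Gal(AlgebraicClosure k/k) (FieldPoints f) := by
  refine ⟨fun x y => ?_⟩
  obtain ⟨θ, hθ⟩ := exists_ringEquiv_of_isIntegral x.1 y.1 x.isIntegral y.isIntegral
  refine ⟨AlgEquiv.ofRingEquiv (f := θ) fun a => ?_, FieldPoints.ext hθ⟩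
  rw [← RingHom.congr_fun x.2 a, RingHom.comp_apply, hθ, ← RingHom.comp_apply, y.2,
    ← RingHom.comp_apply, x.2]

theorem finite_fieldPoints {f : k →+* B} (hf : f.Finite) : Finite (FieldPoints f) := by
  let := f.toAlgebra
  have : Module.Finite k B := hf
  let F : FieldPoints f → (B →ₐ[k] AlgebraicClosure k) :=
    fun x => ⟨x.1, RingHom.congr_fun x.2⟩
  exact Finite.of_injective F fun x y h => FieldPoints.ext fun b => DFunLike.congr_fun h b

theorem nonempty_fieldPoints {f : k →+* B} (hf : f.IsIntegral) : Nonempty (FieldPoints f) := by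
  obtain ⟨x, hx⟩ := exists_comp_eq_of_isIntegral f hf (algebraMap k (AlgebraicClosure k))
  exact ⟨⟨x, hx⟩⟩

theorem resPoints_surjective {f : k →+* B} {h : k →+* C} (g : B →+* C) (hg : g.comp f = h)
    (hi : g.IsIntegral) : Function.Surjective (resPoints g hg) := by
  intro y
  obtain ⟨x, hx⟩ := exists_comp_eq_of_isIntegral g hi y.1
  exact ⟨⟨x, by rw [← hg, ← RingHom.comp_assoc, hx, y.2]⟩, Subtype.ext hx⟩

/-! ### The Galois correspondence for subfields of the algebraic closure -/

/-- Characteristic zero makes the algebraic closure Galois over `k`, so `D` is the fixed field of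
its fixing group. -/
theorem subfield_le_of_fixing [CharZero k] {D D' : Subfield (AlgebraicClosure k)}
    (hD : ∀ a : k, algebraMap k (AlgebraicClosure k) a ∈ D)
    (h : ∀ σ : Gal(AlgebraicClosure k/k), (∀ d ∈ D, σ d = d) → ∀ d ∈ D', σ d = d) : D' ≤ D := by
  intro d hd
  let E : IntermediateField k (AlgebraicClosure k) := D.toIntermediateField hD
  have h1 : d ∈ IntermediateField.fixedField E.fixingSubgroup := by
    rw [IntermediateField.mem_fixedField_iff]
    intro σ hσ
    exact h σ ((IntermediateField.mem_fixingSubgroup_iff _ _).1 hσ) d hd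
  rw [InfiniteGalois.fixedField_fixingSubgroup] at h1
  exact h1

/-- The stabilizer of `x` fixes a finite extension and is open; hence `H` is open, so closed, and
the infinite Galois correspondence applies to it. -/
theorem exists_subfield_of_stabilizer_le [CharZero k] {f : k →+* B} (hf : f.Finite)
    (x : FieldPoints f) {H : Subgroup Gal(AlgebraicClosure k/k)} (hH : stabilizer _ x ≤ H) :
    ∃ D : Subfield (AlgebraicClosure k), (∀ a : k, algebraMap k (AlgebraicClosure k) a ∈ D) ∧
      ∀ σ, σ ∈ H ↔ ∀ d ∈ D, σ d = d := by
  let E : IntermediateField k (AlgebraicClosure k) := x.1.fieldRange.toIntermediateField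
    fun a => ⟨f a, RingHom.congr_fun x.2 a⟩
  have hE : E.fixingSubgroup ≤ H := by
    intro σ hσ
    refine hH (FieldPoints.ext fun b => ?_)
    exact (IntermediateField.mem_fixingSubgroup_iff _ _).1 hσ _ ⟨b, rfl⟩
  have : FiniteDimensional k E := by
    let := f.toAlgebra
    have : Module.Finite k B := hf
    let F : B →ₐ[k] AlgebraicClosure k := ⟨x.1, RingHom.congr_fun x.2⟩
    have hF : E = F.fieldRange := IntermediateField.ext fun _ => Iff.rfl
    rw [hF]
    exact (AlgEquiv.ofInjectiveField F).toLinearEquiv.finiteDimensional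
  have hclosed : IsClosed (H : Set Gal(AlgebraicClosure k/k)) :=
    Subgroup.isClosed_of_isOpen H (Subgroup.isOpen_mono hE E.fixingSubgroup_isOpen)
  refine ⟨(IntermediateField.fixedField H).toSubfield,
    fun a => (IntermediateField.fixedField H).algebraMap_mem a, fun σ => ?_⟩
  have h1 := IntermediateField.mem_fixingSubgroup_iff (IntermediateField.fixedField H) σ
  rw [InfiniteGalois.fixingSubgroup_fixedField ⟨H, hclosed⟩] at h1
  exact h1

theorem mem_stabilizer_fieldPoints_iff {f : k →+* B} {x : FieldPoints f}
    {σ : Gal(AlgebraicClosure k/k)} :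
    σ ∈ stabilizer _ x ↔ ∀ d ∈ x.1.fieldRange, σ d = d := by
  rw [mem_stabilizer_iff, FieldPoints.smul_eq_iff]
  exact ⟨fun h d ⟨b, hb⟩ => hb ▸ h b, fun h b => h _ ⟨b, rfl⟩⟩

theorem algebraMap_mem_fieldRange {f : k →+* B} (x : FieldPoints f) (a : k) :
    algebraMap k (AlgebraicClosure k) a ∈ x.1.fieldRange := ⟨f a, RingHom.congr_fun x.2 a⟩

/-- A group between the two stabilizers corresponds to a field between the images of `B` and `C`
under `x`; pulled back along `x` it is an intermediate field of `C/B`. -/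
theorem stabilizer_covBy [CharZero k] {f : k →+* B} {h : k →+* C} (hh : h.Finite) (g : B →+* C)
    (hg : g.comp f = h)
    (hs : letI := g.toAlgebra; IsSimpleOrder (IntermediateField B C)) (x : FieldPoints h) :
    stabilizer Gal(AlgebraicClosure k/k) x ⋖
      stabilizer Gal(AlgebraicClosure k/k) (resPoints g hg x) := by
  let := g.toAlgebra
  have hle : stabilizer Gal(AlgebraicClosure k/k) x ≤ stabilizer _ (resPoints g hg x) := by
    intro σ hσ
    rw [mem_stabilizer_iff] at hσ ⊢
    rw [← map_smul, hσ]
  refine covBy_iff_lt_and_eq_or_eq.2 ⟨lt_of_le_of_ne hle fun heq => ?_, fun H h1 h2 => ?_⟩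
  · have hle : x.1.fieldRange ≤ (resPoints g hg x).1.fieldRange :=
      subfield_le_of_fixing (algebraMap_mem_fieldRange _) fun σ hσ =>
        mem_stabilizer_fieldPoints_iff.1 (heq ▸ mem_stabilizer_fieldPoints_iff.2 hσ)
    refine bot_ne_top (α := IntermediateField B C) (top_le_iff.1 fun c _ => ?_)
    obtain ⟨b, hb⟩ := hle ⟨c, rfl⟩
    exact IntermediateField.mem_bot.2 ⟨b, x.1.injective hb⟩
  · obtain ⟨D, hD, hDH⟩ := exists_subfield_of_stabilizer_le hh x h1
    have hDx : D ≤ x.1.fieldRange :=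
      subfield_le_of_fixing (algebraMap_mem_fieldRange _) fun σ hσ =>
        (hDH σ).1 (h1 (mem_stabilizer_fieldPoints_iff.2 hσ))
    have hDy : (resPoints g hg x).1.fieldRange ≤ D :=
      subfield_le_of_fixing hD fun σ hσ =>
        mem_stabilizer_fieldPoints_iff.1 (h2 ((hDH σ).2 hσ))
    let D' : IntermediateField B C := (D.comap x.1).toIntermediateField fun b => hDy ⟨b, rfl⟩
    rcases hs.eq_bot_or_eq_top D' with h' | h'
    · right
      refine le_antisymm h2 fun σ hσ => (hDH σ).2 fun d hd => ?_
      refine mem_stabilizer_fieldPoints_iff.1 hσ d ?_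
      obtain ⟨c, rfl⟩ := hDx hd
      have : c ∈ D' := hd
      rw [h', IntermediateField.mem_bot] at this
      obtain ⟨b, rfl⟩ := this
      exact ⟨b, rfl⟩
    · left
      refine le_antisymm (fun σ hσ => mem_stabilizer_fieldPoints_iff.2 ?_) h1
      rintro _ ⟨c, rfl⟩
      have : c ∈ D' := h' ▸ IntermediateField.mem_top
      exact (hDH σ).1 hσ _ this

theorem exists_moving_of_normalClosure_ne [CharZero k] {f : k →+* B} {h : k →+* C} (g : B →+* C)
    (hg : g.comp f = h) (hi : g.IsIntegral)
    (hne : (letI := f.toAlgebra; IntermediateField.normalClosure k B (AlgebraicClosure k)) ≠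
      (letI := h.toAlgebra; IntermediateField.normalClosure k C (AlgebraicClosure k))) :
    ∃ σ : Gal(AlgebraicClosure k/k), (∀ y : FieldPoints f, σ • y = y) ∧
      ∃ x : FieldPoints h, σ • x ≠ x := by
  by_contra! hcon
  let := f.toAlgebra
  let := h.toAlgebra
  refine hne (le_antisymm (iSup_le fun y => ?_) ?_)
  · obtain ⟨x, hx⟩ := resPoints_surjective g hg hi ⟨y.toRingHom, y.comp_algebraMap⟩
    let x' : C →ₐ[k] AlgebraicClosure k := ⟨x.1, RingHom.congr_fun x.2⟩
    refine le_trans ?_ (le_iSup _ x')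
    rintro _ ⟨b, rfl⟩
    exact ⟨g b, RingHom.congr_fun (congrArg Subtype.val hx) b⟩
  · rw [← InfiniteGalois.fixedField_fixingSubgroup
      (IntermediateField.normalClosure k B (AlgebraicClosure k)),
      IntermediateField.le_iff_le]
    intro σ hσ
    rw [IntermediateField.mem_fixingSubgroup_iff] at hσ
    have h1 : ∀ y : FieldPoints f, σ • y = y := fun y => FieldPoints.ext fun b => by
      let y' : B →ₐ[k] AlgebraicClosure k := ⟨y.1, RingHom.congr_fun y.2⟩
      exact hσ _ (le_iSup (fun y : B →ₐ[k] AlgebraicClosure k => y.fieldRange) y' ⟨b, rfl⟩)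
    have h2 := hcon σ h1
    -- Passing through the fixed field of the group generated by `σ` lets the Galois connection
    -- return membership of `σ` in the fixing group.
    have h3 : IntermediateField.normalClosure k C (AlgebraicClosure k) ≤
        IntermediateField.fixedField (Subgroup.zpowers σ) := by
      refine iSup_le fun x => ?_
      rintro _ ⟨c, rfl⟩
      rw [IntermediateField.mem_fixedField_iff]
      let x' : FieldPoints h := ⟨x.toRingHom, x.comp_algebraMap⟩
      have hs : σ ∈ stabilizer _ x' := h2 x'
      intro τ hτ
      have := (Subgroup.zpowers_le.2 hs) hτ
      exact FieldPoints.smul_eq_iff.1 this c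
    rw [IntermediateField.le_iff_le] at h3
    exact h3 (Subgroup.mem_zpowers σ)

end Points

/-! ### Change of the base field -/

section Transfer

variable {k B C : Type u} [Field k] [Field B] [Field C] [Algebra B C] {f : k →+* B} {h : k →+* C}
  (hg : (algebraMap B C).comp f = h) {y : FieldPoints f}
  (θ : AlgebraicClosure B ≃+* AlgebraicClosure k)
  (hθ : ∀ b, θ (algebraMap B (AlgebraicClosure B) b) = y.1 b)

theorem exists_closure_equiv (y : FieldPoints f) :
    ∃ θ : AlgebraicClosure B ≃+* AlgebraicClosure k,
      ∀ b, θ (algebraMap B (AlgebraicClosure B) b) = y.1 b :=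
  exists_ringEquiv_of_isIntegral _ _ Algebra.IsIntegral.isIntegral y.isIntegral

include hθ in
-- Conjugation by `θ` carries the Galois group of `B` to the stabilizer of the point `y`; this and
-- the converse `exists_conj_symm` identify monodromy over `B` with the action on a fibre.
theorem exists_conj (s : Gal(AlgebraicClosure B/B)) : ∃ a : Gal(AlgebraicClosure k/k),
    a • y = y ∧ ∀ t, a (θ t) = θ (s t) := by
  have key : ∀ b, θ (s (θ.symm (y.1 b))) = y.1 b := fun b => by
    rw [← hθ, RingEquiv.symm_apply_apply, AlgEquiv.commutes]
  refine ⟨AlgEquiv.ofRingEquiv (f := (θ.symm.trans s.toRingEquiv).trans θ) fun a => ?_,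
    FieldPoints.ext key, fun t => ?_⟩
  · rw [← RingHom.congr_fun y.2 a]
    exact key (f a)
  · exact congrArg (fun t => θ (s t)) (θ.symm_apply_apply t)

include hθ in
theorem exists_conj_symm (a : Gal(AlgebraicClosure k/k)) (ha : a • y = y) :
    ∃ s : Gal(AlgebraicClosure B/B), ∀ t, a (θ t) = θ (s t) := by
  refine ⟨AlgEquiv.ofRingEquiv (f := (θ.trans a.toRingEquiv).trans θ.symm) fun b => ?_,
    fun t => (θ.apply_symm_apply _).symm⟩
  change θ.symm (a (θ _)) = _
  rw [hθ, FieldPoints.smul_eq_iff.1 ha b, ← hθ, RingEquiv.symm_apply_apply]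

/-- The geometric fibre of `C/B` is a fibre of the restriction map. -/
noncomputable def geomFiberEquiv : GeomFiber B C ≃ {x // resPoints (algebraMap B C) hg x = y} where
  toFun c := ⟨⟨(θ : AlgebraicClosure B →+* AlgebraicClosure k).comp c.toRingHom, by
      rw [← hg]
      refine RingHom.ext fun a => (Eq.trans ?_ (RingHom.congr_fun y.2 a))
      exact (congrArg θ (c.commutes (f a))).trans (hθ (f a))⟩,
    FieldPoints.ext fun b => (congrArg θ (c.commutes b)).trans (hθ b)⟩
  invFun x := ⟨(θ.symm : AlgebraicClosure k →+* AlgebraicClosure B).comp x.1.1, fun b => by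
    have h1 := RingHom.congr_fun (congrArg Subtype.val x.2) b
    have h2 := (h1.trans (hθ b).symm)
    exact (congrArg θ.symm h2).trans (θ.symm_apply_apply _)⟩
  left_inv c := AlgHom.ext fun t => θ.symm_apply_apply _
  right_inv x := Subtype.ext (FieldPoints.ext fun t => θ.apply_symm_apply _)

theorem geomFiberEquiv_conj {s : Gal(AlgebraicClosure B/B)} {a : Gal(AlgebraicClosure k/k)}
    (ha : a ∈ stabilizer _ y) (has : ∀ t, a (θ t) = θ (s t)) :
    (geomFiberEquiv hg θ hθ).permCongrHom (galoisAction B C s) =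
      fiberHom (resPoints (algebraMap B C) hg) y ⟨a, ha⟩ := by
  refine Equiv.ext fun x => ?_
  obtain ⟨c, rfl⟩ := (geomFiberEquiv hg θ hθ).surjective x
  refine (congrArg (geomFiberEquiv hg θ hθ)
    (congrArg (galoisAction B C s) ((geomFiberEquiv hg θ hθ).symm_apply_apply c))).trans ?_
  exact Subtype.ext (FieldPoints.ext fun t => (has (c t)).symm)

theorem fieldMonodromy_map_geomFiberEquiv :
    (fieldMonodromy B C).map ((geomFiberEquiv hg θ hθ).permCongrHom : _ →* _) =
      fiberGroup (resPoints (algebraMap B C) hg) y := by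
  ext σ
  constructor
  · rintro ⟨_, ⟨s, rfl⟩, rfl⟩
    obtain ⟨a, ha, has⟩ := exists_conj θ hθ s
    exact ⟨⟨a, ha⟩, (geomFiberEquiv_conj hg θ hθ ha has).symm⟩
  · rintro ⟨⟨a, ha⟩, rfl⟩
    obtain ⟨s, has⟩ := exists_conj_symm θ hθ a ha
    exact ⟨_, ⟨s, rfl⟩, geomFiberEquiv_conj hg θ hθ ha has⟩

include hg in
theorem nonempty_geomFiber_equiv (y : FieldPoints f) :
    Nonempty (GeomFiber B C ≃ {x // resPoints (algebraMap B C) hg x = y}) := by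
  obtain ⟨θ, hθ⟩ := exists_closure_equiv y
  exact ⟨geomFiberEquiv hg θ hθ⟩

theorem isNonabelianAlmostSimple_fiberGroup (h : IsNonabelianAlmostSimple (fieldMonodromy B C))
    (y : FieldPoints f) :
    IsNonabelianAlmostSimple (fiberGroup (resPoints (algebraMap B C) hg) y) := by
  obtain ⟨θ, hθ⟩ := exists_closure_equiv y
  rw [← fieldMonodromy_map_geomFiberEquiv hg θ hθ]
  exact h.of_mulEquiv ((geomFiberEquiv hg θ hθ).permCongrHom.subgroupMap _)

theorem nonempty_innerSocle_equiv_fiberSocle (y : FieldPoints f) :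
    Nonempty (innerSocle (fieldMonodromy B C) ≃*
      fiberSocle (resPoints (algebraMap B C) hg) y) := by
  obtain ⟨θ, hθ⟩ := exists_closure_equiv y
  rw [fiberSocle, ← fieldMonodromy_map_geomFiberEquiv hg θ hθ, innerSocle_map]
  exact ⟨(geomFiberEquiv hg θ hθ).permCongrHom.subgroupMap _⟩

end Transfer

section Diagonal

variable {k Z B C : Type u} [Field k] [Field Z] [Field B] [Field C] [Algebra Z B] [Algebra B C]
  [Algebra Z C] [IsScalarTower Z B C]

/-- If `σ ≠ τ` in the kernel agree on the block of `y0`, then `τ⁻¹ * σ` is trivial on that block but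
not everywhere. It is induced by the Galois group of `Z`, and conjugation by `θ` transports it to
the Galois group of `k`. -/
theorem exists_of_not_isDiagonalKernel {e : k →+* Z} {f : k →+* B} {h : k →+* C}
    (hf : (algebraMap Z B).comp e = f) (hh : (algebraMap B C).comp f = h) (he : e.IsIntegral)
    (hi : (algebraMap B C).IsIntegral) (hd : ¬ IsDiagonalKernel Z B C) :
    ∃ (y : FieldPoints f) (a : Gal(AlgebraicClosure k/k)),
      (∀ y', resPoints (algebraMap Z B) hf y' = resPoints (algebraMap Z B) hf y → a • y' = y') ∧
      (∀ x, resPoints (algebraMap B C) hh x = y → a • x = x) ∧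
      ∃ x, resPoints (algebraMap Z B) hf (resPoints (algebraMap B C) hh x) =
        resPoints (algebraMap Z B) hf y ∧ a • x ≠ x := by
  unfold IsDiagonalKernel Function.Injective at hd
  push Not at hd
  obtain ⟨y0, σ, τ, hστ, hne⟩ := hd
  obtain ⟨z⟩ := nonempty_fieldPoints he
  obtain ⟨θ, hθ⟩ := exists_closure_equiv z
  have hρ := (τ⁻¹ * σ).2
  obtain ⟨⟨s, hs⟩, hres⟩ := hρ
  have hsx : ∀ x, galoisAction Z C s x = τ.1⁻¹ (σ.1 x) := fun x => by rw [hs]; rfl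
  obtain ⟨a, haz, has⟩ := exists_conj θ hθ s
  have hh' : (algebraMap Z C).comp e = h := by
    rw [← hh, ← hf, ← RingHom.comp_assoc, ← IsScalarTower.algebraMap_eq]
  let E1 := geomFiberEquiv hf θ hθ
  let E2 := geomFiberEquiv hh' θ hθ
  have hE : ∀ x : GeomFiber Z C, resPoints (algebraMap B C) hh (E2 x).1 =
      (E1 (restrictFiber Z B C x)).1 := fun x => rfl
  have hact1 : ∀ x : GeomFiber Z B, a • (E1 x).1 = (E1 (galoisAction Z B s x)).1 := fun x =>
    FieldPoints.ext fun t => has (x t)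
  have hact2 : ∀ x : GeomFiber Z C, a • (E2 x).1 = (E2 (galoisAction Z C s x)).1 := fun x =>
    FieldPoints.ext fun t => has (x t)
  have hz : ∀ y, resPoints (algebraMap Z B) hf (E1 y).1 = z := fun y => (E1 y).2
  -- The kernel condition is stated at points of the fibre of `C/Z`, so each embedding of `B` is
  -- first extended to `C`.
  have hbase : ∀ y, galoisAction Z B s y = y := by
    intro y
    obtain ⟨x, hx⟩ := exists_comp_eq_of_isIntegral (algebraMap B C) hi y.toRingHom
    let x' : GeomFiber Z C := ⟨x, fun r => by
      rw [IsScalarTower.algebraMap_apply Z B C]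
      exact (RingHom.congr_fun hx _).trans (y.commutes r)⟩
    have h1 : restrictFiber Z B C x' = y := AlgHom.ext fun b => RingHom.congr_fun hx b
    have h2 := hres x'
    rw [h1] at h2
    refine Eq.trans ?_ h2
    rw [← hs, ← h1]
    rfl
  refine ⟨(E1 y0).1, a, fun y' hy' => ?_, fun x hx => ?_, ?_⟩
  · rw [hz] at hy'
    have : y' = (E1 (E1.symm ⟨y', hy'⟩)).1 := by rw [Equiv.apply_symm_apply]
    rw [this, hact1, hbase]
  · have hx' : resPoints (algebraMap Z C) hh' x = z := by
      rw [← hz y0, ← hx]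
      exact FieldPoints.ext fun t => congrArg x.1 (IsScalarTower.algebraMap_apply Z B C t)
    obtain ⟨c, hc⟩ := E2.surjective ⟨x, hx'⟩
    have hxc : x = (E2 c).1 := by rw [hc]
    subst hxc
    rw [hE] at hx
    have hcy : restrictFiber Z B C c = y0 := E1.injective (Subtype.ext hx)
    have h3 := congrArg Subtype.val (DFunLike.congr_fun hστ ⟨c, hcy⟩)
    have h4 : σ.1 c = τ.1 c := h3
    rw [hact2, hsx, h4]
    exact congrArg (fun c => (E2 c).1) (Equiv.symm_apply_apply τ.1 c)
  · have : ∃ c, σ.1 c ≠ τ.1 c := by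
      by_contra! h5
      exact hne (Subtype.ext (Equiv.ext h5))
    obtain ⟨c, hc⟩ := this
    refine ⟨(E2 c).1, ?_, fun h6 => hc ?_⟩
    · rw [hE, hz, hz]
    · rw [hact2, hsx] at h6
      have h7 := E2.injective (Subtype.ext h6)
      rwa [Equiv.Perm.inv_eq_iff_eq] at h7

end Diagonal

/-! ### Function fields of finite dominant morphisms -/

/-- Finitely many generators of `S` over `R` are integral over `K`, so they generate a finite
subextension; it contains the image of `S`, hence all fractions. -/
theorem finite_of_finite_of_isFractionRing {R S K L : Type*} [CommRing R] [CommRing S]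
    [Field K] [Field L] [Algebra S L] [IsFractionRing S L] (i : R →+* K) (ψ : R →+* S)
    (φ : K →+* L) (h : φ.comp i = (algebraMap S L).comp ψ) (hψ : ψ.Finite) : φ.Finite := by
  let := φ.toAlgebra
  let := ψ.toAlgebra
  have : Module.Finite R S := hψ
  have hint : ∀ s : S, _root_.IsIntegral K (algebraMap S L s) := by
    intro s
    obtain ⟨p, hp, hps⟩ := Algebra.IsIntegral.isIntegral (R := R) s
    refine ⟨p.map i, hp.map i, ?_⟩
    have h1 := congrArg (algebraMap S L) hps
    rw [map_zero, Polynomial.hom_eval₂] at h1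
    rw [Polynomial.eval₂_map]
    change Polynomial.eval₂ (φ.comp i) _ _ = 0
    rw [h]
    exact h1
  obtain ⟨t, ht⟩ := Module.Finite.fg_top (R := R) (M := S)
  let E : IntermediateField K L := IntermediateField.adjoin K (algebraMap S L '' t)
  have hE : FiniteDimensional K E := by
    have : _root_.Finite (algebraMap S L '' t) := (t.finite_toSet.image _).to_subtype
    refine IntermediateField.finiteDimensional_adjoin ?_
    rintro _ ⟨s, -, rfl⟩
    exact hint s
  have hS : ∀ s : S, algebraMap S L s ∈ E := by
    intro s
    have hs : s ∈ Submodule.span R (t : Set S) := ht ▸ Submodule.mem_top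
    induction hs using Submodule.span_induction with
    | mem x hx => exact IntermediateField.subset_adjoin _ _ ⟨x, hx, rfl⟩
    | zero => rw [map_zero]; exact zero_mem E
    | add x y _ _ hx hy => rw [map_add]; exact add_mem hx hy
    | smul a x _ hx =>
      rw [Algebra.smul_def, map_mul]
      refine mul_mem ?_ hx
      have h1 : algebraMap S L (algebraMap R S a) = algebraMap K L (i a) :=
        (RingHom.congr_fun h a).symm
      rw [h1]
      exact E.algebraMap_mem _
  have htop : E = ⊤ := by
    refine top_le_iff.1 fun x _ => ?_
    obtain ⟨a, b, -, rfl⟩ := IsFractionRing.div_surjective S x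
    exact div_mem (hS a) (hS b)
  rw [htop] at hE
  exact Module.Finite.equiv (IntermediateField.topEquiv (F := K) (E := L)).toLinearEquiv

section FunctionField

variable {X Y : Scheme.{u}} [IsIntegral X] [IsIntegral Y]

theorem functionFieldMap_germ (f : X ⟶ Y) [IsDominant f] (U : Y.Opens) (hU : genericPoint Y ∈ U)
    (hU' : genericPoint X ∈ f ⁻¹ᵁ U) :
    (functionFieldMap f).comp (Y.presheaf.germ U (genericPoint Y) hU).hom =
      (X.presheaf.germ (f ⁻¹ᵁ U) (genericPoint X) hU').hom.comp (f.app U).hom := by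
  simp only [functionFieldMap, ← CommRingCat.hom_comp]
  congr 1
  simp

/-- Over an affine open around the generic point the map is a finite ring map, and the function
field of `X` is the fraction field of the sections on the affine preimage. -/
theorem functionFieldMap_finite (f : X ⟶ Y) [IsDominant f] [IsFinite f] :
    (functionFieldMap f).Finite := by
  obtain ⟨U, hU, hxU, -⟩ := exists_isAffineOpen_mem_and_subset
    (x := genericPoint Y) (U := ⊤) trivial
  have hU' : genericPoint X ∈ f ⁻¹ᵁ U := by
    change f (genericPoint X) ∈ U
    rwa [map_genericPoint]
  have : Nonempty (f ⁻¹ᵁ U) := ⟨⟨_, hU'⟩⟩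
  have hfr := functionField_isFractionRing_of_isAffineOpen X (f ⁻¹ᵁ U) (hU.preimage f)
  exact finite_of_finite_of_isFractionRing _ _ _ (functionFieldMap_germ f U hxU hU')
    (IsFinite.finite_app f U hU)

theorem functionFieldMap_id (f : X ⟶ X) [IsDominant f] (hf : f = 𝟙 X) :
    functionFieldMap f = RingHom.id _ := by
  subst hf
  refine RingHom.ext fun x => ?_
  simp [functionFieldMap]

theorem functionFieldMap_congr {f g : X ⟶ Y} [IsDominant f] [IsDominant g] (h : f = g) :
    functionFieldMap f = functionFieldMap g := by
  subst h
  rfl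

theorem charZero_functionField {F : Type u} [Field F] [CharZero F] (f : X ⟶ Spec (.of F)) :
    CharZero X.functionField := by
  let φ : F →+* X.functionField :=
    (X.presheaf.germ ⊤ (genericPoint X) trivial).hom.comp
      (f.appTop.hom.comp (Scheme.ΓSpecIso (.of F)).inv.hom)
  exact charZero_of_injective_ringHom φ.injective

end FunctionField

/-! ### Maximal chains -/

theorem covBy_chain_iff {α : Type*} [PartialOrder α] [OrderTop α] {r : ℕ} (E : Fin (r + 1) → α)
    (hE : StrictMono E) (htop : E (Fin.last r) = ⊤) (hex : ∀ D, E 0 ≤ D → ∃ j, D = E j)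
    (s : ℕ) (M : Fin (s + 1) → α) :
    (M 0 = E 0 ∧ M (Fin.last s) = ⊤ ∧ ∀ i : Fin s, M i.castSucc ⋖ M i.succ) ↔
      ∃ h : s = r, ∀ i : Fin (s + 1), M i = E (i.cast (by rw [h])) := by
  constructor
  · rintro ⟨h0, hl, hc⟩
    -- Every member of `M` occurs in `E`, and a covering step cannot skip an index, because the
    -- skipped term of `E` would lie strictly in between.
    have key : ∀ i : Fin (s + 1), ∃ h : i.1 < r + 1, M i = E ⟨i.1, h⟩ := by
      intro i
      induction i using Fin.induction with
      | zero => exact ⟨Nat.succ_pos r, h0⟩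
      | succ i ih =>
        obtain ⟨hi, hMi⟩ := ih
        have hci := hc i
        rw [hMi] at hci
        obtain ⟨j, hj⟩ := hex (M i.succ) ((hE.monotone (Fin.zero_le _)).trans hci.le)
        rw [hj] at hci
        have hlt := hE.lt_iff_lt.1 hci.lt
        have hi' : i.1 + 1 < r + 1 := lt_of_le_of_lt (Nat.succ_le_of_lt hlt) j.2
        refine ⟨hi', ?_⟩
        have h1 : (⟨i.1 + 1, hi'⟩ : Fin (r + 1)) ≤ j := Nat.succ_le_of_lt hlt
        rcases h1.eq_or_lt with h1 | h1
        · rw [hj, ← h1]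
          rfl
        · exact (hci.2 (hE (show (⟨i.1, hi⟩ : Fin (r + 1)) < ⟨i.1 + 1, hi'⟩ from Nat.lt_succ_self _))
            (hE h1)).elim
    have hs : s = r := by
      obtain ⟨h, hM⟩ := key (Fin.last s)
      rw [hl, ← htop] at hM
      exact (congrArg Fin.val (hE.injective hM)).symm
    exact ⟨hs, fun i => (key i).2⟩
  · rintro ⟨rfl, hM⟩
    refine ⟨hM 0, (hM _).trans htop, fun i => ?_⟩
    rw [hM, hM]
    refine ⟨hE i.castSucc_lt_succ, fun D h1 h2 => ?_⟩
    obtain ⟨j, rfl⟩ := hex D ((hE.monotone (Fin.zero_le _)).trans h1.le)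
    have h1 := hE.lt_iff_lt.1 h1
    have h2 := hE.lt_iff_lt.1 h2
    simp only [Fin.lt_def, Fin.val_cast, Fin.val_castSucc, Fin.val_succ] at h1 h2
    omega

/-! ### The tower of points of a sequence of maps -/

namespace MapSequence

variable {F : Type u} [Field F] {r : ℕ} (S : MapSequence F r)

instance {i j : Fin (r + 1)} (h : i ≤ j) : IsFinite (S.map h) := S.isFinite _

theorem map_trans {i j k : Fin (r + 1)} (h : i ≤ j) (h' : j ≤ k) :
    S.map (h.trans h') = S.map h' ≫ S.map h := by
  unfold map
  exact congrArg (fun f => f.left) (S.diagram.map_comp (homOfLE h').op (homOfLE h).op)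

theorem map_refl (i : Fin (r + 1)) : S.map (le_refl i) = 𝟙 (S.obj i) := by
  unfold map
  exact (congrArg (fun f => f.left) (S.diagram.map_id (.op i)))

/-- The inclusion `F(X_i) → F(X_j)` of function fields. -/
noncomputable abbrev fieldMap {i j : Fin (r + 1)} (h : i ≤ j) :
    (S.obj i).functionField →+* (S.obj j).functionField := functionFieldMap (S.map h)

theorem fieldMap_comp {i j k : Fin (r + 1)} (h : i ≤ j) (h' : j ≤ k) :
    (S.fieldMap h').comp (S.fieldMap h) = S.fieldMap (h.trans h') := by
  rw [← functionFieldMap_comp]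
  exact functionFieldMap_congr (S.map_trans h h').symm

theorem fieldMap_refl (i : Fin (r + 1)) : S.fieldMap (le_refl i) = RingHom.id _ :=
  functionFieldMap_id _ (S.map_refl i)

theorem fieldMap_finite {i j : Fin (r + 1)} (h : i ≤ j) : (S.fieldMap h).Finite :=
  functionFieldMap_finite _

theorem fieldMap_isIntegral {i j : Fin (r + 1)} (h : i ≤ j) : (S.fieldMap h).IsIntegral :=
  RingHom.Finite.to_isIntegral (S.fieldMap_finite h)

/-- The geometric generic fibre of `X_i → X_0`. -/
abbrev Points (i : Fin (r + 1)) : Type u := FieldPoints (S.fieldMap i.zero_le)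

/-- The absolute Galois group of `F(X_0)`. -/
abbrev GaloisGroup : Type u :=
  Gal(AlgebraicClosure (S.obj 0).functionField/(S.obj 0).functionField)

/-- The restriction map between geometric generic fibres. -/
noncomputable def res {i j : Fin (r + 1)} (h : i ≤ j) : S.Points j →[S.GaloisGroup] S.Points i :=
  resPoints (S.fieldMap h) (S.fieldMap_comp i.zero_le h)

theorem res_refl {i : Fin (r + 1)} (x : S.Points i) : S.res le_rfl x = x :=
  FieldPoints.ext fun b => congrArg x.1 (RingHom.congr_fun (S.fieldMap_refl i) b)

theorem res_res {i j k : Fin (r + 1)} (h : i ≤ j) (h' : j ≤ k) (x : S.Points k) :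
    S.res h (S.res h' x) = S.res (h.trans h') x :=
  FieldPoints.ext fun b => congrArg x.1 (RingHom.congr_fun (S.fieldMap_comp h h') b)

instance (i : Fin (r + 1)) : Finite (S.Points i) := finite_fieldPoints (S.fieldMap_finite _)

theorem nonempty_points (i : Fin (r + 1)) : Nonempty (S.Points i) :=
  nonempty_fieldPoints (S.fieldMap_isIntegral _)

theorem res_surjective {i j : Fin (r + 1)} (h : i ≤ j) : Function.Surjective (S.res h) :=
  resPoints_surjective _ _ (S.fieldMap_isIntegral h)

instance : Subsingleton (S.Points 0) := by
  refine ⟨fun x y => FieldPoints.ext fun b => ?_⟩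
  have key : ∀ x : S.Points 0, x.1 b = algebraMap _ _ b := fun x =>
    (congrArg x.1 (RingHom.congr_fun (S.fieldMap_refl 0) b).symm).trans (RingHom.congr_fun x.2 b)
  rw [key, key]

instance [CharZero F] (i : Fin (r + 1)) : CharZero (S.obj i).functionField :=
  charZero_functionField (S.diagram.obj (.op i)).hom

theorem isNonabelianAlmostSimple_fiberGroup_res {i : Fin r}
    (has : IsNonabelianAlmostSimple (MonodromyGroup (S.step i))) (y : S.Points i.castSucc) :
    IsNonabelianAlmostSimple (fiberGroup (S.res i.castSucc_le_succ) y) :=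
  letI := functionFieldAlgebra (S.step i)
  isNonabelianAlmostSimple_fiberGroup (S.fieldMap_comp _ i.castSucc_le_succ) has y

theorem nonempty_mapFiber_equiv (i : Fin r) (y : S.Points i.castSucc) :
    Nonempty (MapFiber (S.step i) ≃ {x // S.res i.castSucc_le_succ x = y}) :=
  letI := functionFieldAlgebra (S.step i)
  nonempty_geomFiber_equiv (S.fieldMap_comp _ i.castSucc_le_succ) y

theorem nonempty_socMon_equiv (i : Fin r) (y : S.Points i.castSucc) :
    Nonempty (socMon (S.step i) ≃* fiberSocle (S.res i.castSucc_le_succ) y) :=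
  letI := functionFieldAlgebra (S.step i)
  nonempty_innerSocle_equiv_fiberSocle (S.fieldMap_comp _ i.castSucc_le_succ) y

theorem stabilizer_covBy_res [CharZero F] {i : Fin r} (hind : IsIndecomposableMap (S.step i))
    (x : S.Points i.succ) :
    stabilizer S.GaloisGroup x ⋖ stabilizer S.GaloisGroup (S.res i.castSucc_le_succ x) :=
  stabilizer_covBy (S.fieldMap_finite _) _ (S.fieldMap_comp _ i.castSucc_le_succ) hind x

theorem exists_moving_of_mapGaloisClosure_ne [CharZero F] {i j : Fin (r + 1)} (h : i ≤ j)
    (hne : mapGaloisClosure (S.partialComp i) ≠ mapGaloisClosure (S.partialComp j)) :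
    ∃ σ : S.GaloisGroup, (∀ y : S.Points i, σ • y = y) ∧ ∃ x : S.Points j, σ • x ≠ x :=
  exists_moving_of_normalClosure_ne (S.fieldMap h) (S.fieldMap_comp _ h)
    (S.fieldMap_isIntegral h) hne

theorem exists_of_not_hasDiagonalKernel {a b c : Fin (r + 1)} (hab : a ≤ b) (hbc : b ≤ c)
    (h : ¬ HasDiagonalKernel (S.map hbc) (S.map hab)) :
    ∃ (y : S.Points b) (σ : S.GaloisGroup),
      (∀ y', S.res hab y' = S.res hab y → σ • y' = y') ∧
      (∀ x, S.res hbc x = y → σ • x = x) ∧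
      ∃ x, S.res hab (S.res hbc x) = S.res hab y ∧ σ • x ≠ x :=
  letI := functionFieldAlgebra (S.map hbc)
  letI := functionFieldAlgebra (S.map hab)
  letI := functionFieldAlgebra (S.map hbc ≫ S.map hab)
  haveI : IsScalarTower (S.obj a).functionField (S.obj b).functionField
      (S.obj c).functionField :=
    .of_algebraMap_eq' (functionFieldMap_comp (S.map hbc) (S.map hab))
  exists_of_not_isDiagonalKernel (S.fieldMap_comp a.zero_le hab) (S.fieldMap_comp b.zero_le hbc)
    (S.fieldMap_isIntegral _) (S.fieldMap_isIntegral hbc) h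

theorem nonempty_range_equiv_monodromyGroup (i : Fin (r + 1)) :
    Nonempty ((toPermHom S.GaloisGroup (S.Points i)).range ≃* MonodromyGroup (S.partialComp i)) := by
  let := functionFieldAlgebra (S.partialComp i)
  let e : S.Points i ≃ MapFiber (S.partialComp i) :=
    { toFun := fun x => (⟨x.1, RingHom.congr_fun x.2⟩ :
        (S.obj i).functionField →ₐ[(S.obj 0).functionField]
          AlgebraicClosure (S.obj 0).functionField)
      invFun := fun x =>
        ⟨AlgHom.toRingHom (x : (S.obj i).functionField →ₐ[(S.obj 0).functionField] _),
          AlgHom.comp_algebraMap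
            (x : (S.obj i).functionField →ₐ[(S.obj 0).functionField] _)⟩
      left_inv := fun _ => rfl
      right_inv := fun _ => rfl }
  have h : ∀ σ : S.GaloisGroup, e.permCongrHom (toPermHom S.GaloisGroup (S.Points i) σ) =
      galoisAction (S.obj 0).functionField (S.obj i).functionField σ := fun σ => rfl
  have h2 : (toPermHom S.GaloisGroup (S.Points i)).range.map (e.permCongrHom : _ →* _) =
      MonodromyGroup (S.partialComp i) := by
    ext τ
    constructor
    · rintro ⟨_, ⟨σ, rfl⟩, rfl⟩
      exact ⟨σ, (h σ).symm⟩
    · rintro ⟨σ, rfl⟩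
      exact ⟨_, ⟨σ, rfl⟩, h σ⟩
  exact ⟨(e.permCongrHom.subgroupMap _).trans (MulEquiv.subgroupCongr h2)⟩

/-- The image of `F(X_i)` in `F(X_r)`. -/
noncomputable abbrev imageField (i : Fin (r + 1)) : Subfield (S.obj (Fin.last r)).functionField :=
  (S.fieldMap (Fin.le_last i)).fieldRange

theorem imageField_last : S.imageField (Fin.last r) = ⊤ := by
  refine top_le_iff.1 fun x _ => ⟨x, ?_⟩
  exact RingHom.congr_fun (S.fieldMap_refl (Fin.last r)) x

theorem imageField_strictMono (hind : ∀ i : Fin r, IsIndecomposableMap (S.step i)) :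
    StrictMono S.imageField := by
  refine Fin.strictMono_iff_lt_succ.2 fun i => lt_of_le_of_ne ?_ fun heq => ?_
  · rintro _ ⟨b, rfl⟩
    exact ⟨S.fieldMap i.castSucc_le_succ b,
      RingHom.congr_fun (S.fieldMap_comp i.castSucc_le_succ (Fin.le_last _)) b⟩
  · let := functionFieldAlgebra (S.step i)
    have hs : IsSimpleOrder (IntermediateField (S.obj i.castSucc).functionField
      (S.obj i.succ).functionField) := hind i
    refine bot_ne_top (α := IntermediateField (S.obj i.castSucc).functionField
      (S.obj i.succ).functionField) (top_le_iff.1 fun c _ => ?_)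
    obtain ⟨b, hb⟩ : S.fieldMap (Fin.le_last i.succ) c ∈ S.imageField i.castSucc :=
      heq ▸ ⟨c, rfl⟩
    refine IntermediateField.mem_bot.2 ⟨b, (S.fieldMap (Fin.le_last i.succ)).injective ?_⟩
    rw [← hb]
    exact RingHom.congr_fun (S.fieldMap_comp i.castSucc_le_succ (Fin.le_last _)) b

/-- A field `D` above the image of `F(X_0)` is embedded by a geometric point `x`; the group fixing
it contains the stabilizer of `x`, so by `hst` it is the stabilizer of some image of `x`, and the
Galois correspondence recovers `D`. -/
theorem exists_eq_imageField [CharZero F]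
    (hst : ∀ (x : S.Points (Fin.last r)) (H : Subgroup S.GaloisGroup), stabilizer _ x ≤ H →
      ∃ (j : Fin (r + 1)) (h : j ≤ Fin.last r), H = stabilizer _ (S.res h x))
    (D : Subfield (S.obj (Fin.last r)).functionField) (hD : S.imageField 0 ≤ D) :
    ∃ j, D = S.imageField j := by
  obtain ⟨x⟩ := S.nonempty_points (Fin.last r)
  let H : Subgroup S.GaloisGroup :=
    { carrier := {σ | ∀ d ∈ D.map x.1, σ d = d}
      one_mem' := fun _ _ => rfl
      mul_mem' := fun {σ τ} hσ hτ d hd => by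
        rw [AlgEquiv.mul_apply, hτ d hd, hσ d hd]
      inv_mem' := fun {σ} hσ d hd => by
        conv_lhs => rw [← hσ d hd]
        exact σ.symm_apply_apply d }
  have hDk : ∀ a, algebraMap _ (AlgebraicClosure (S.obj 0).functionField) a ∈ D.map x.1 :=
    fun a => ⟨S.fieldMap (Fin.zero_le _) a, hD ⟨a, rfl⟩, RingHom.congr_fun x.2 a⟩
  obtain ⟨j, hj, hHj⟩ := hst x H fun σ hσ d hd => by
    obtain ⟨c, -, rfl⟩ := hd
    exact FieldPoints.smul_eq_iff.1 hσ c
  have h1 : D.map x.1 ≤ (S.res hj x).1.fieldRange :=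
    subfield_le_of_fixing (algebraMap_mem_fieldRange _) fun σ hσ =>
      hHj.ge (mem_stabilizer_fieldPoints_iff.2 hσ)
  have h2 : (S.res hj x).1.fieldRange ≤ D.map x.1 :=
    subfield_le_of_fixing hDk fun σ hσ =>
      mem_stabilizer_fieldPoints_iff.1 (hHj.le hσ)
  refine ⟨j, le_antisymm (fun d hd => ?_) ?_⟩
  · obtain ⟨b, hb⟩ := h1 ⟨d, hd, rfl⟩
    exact ⟨b, x.1.injective hb⟩
  · rintro _ ⟨b, rfl⟩
    obtain ⟨d, hd, hdb⟩ := h2 ⟨b, rfl⟩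
    have : d = S.fieldMap (Fin.le_last j) b := x.1.injective hdb
    rwa [← this]

end MapSequence

end

/-! ### The main theorem -/

theorem corollary4p6 {F : Type u} [Field F] [CharZero F] {r : ℕ} (S : MapSequence F r)
    (hind : ∀ i : Fin r, IsIndecomposableMap (S.step i))
    (has : ∀ i : Fin r, IsNonabelianAlmostSimple (MonodromyGroup (S.step i)))
    (hgal : Function.Injective fun i : Fin r => mapGaloisClosure (S.partialComp i.succ))
    (hdiag : ∀ (a b c : Fin (r + 1)) (hab : a ⋖ b) (hbc : b ⋖ c),
      ¬ HasDiagonalKernel (S.map hbc.le) (S.map hab.le)) :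
    ContainsCompositionFactors (MonodromyGroup (S.partialComp (Fin.last r)))
      (iteratedWreathProduct r (fun i => MapFiber (S.step i)) (fun i => socMon (S.step i))) ∧
    ∀ (s : ℕ) (M : Fin (s + 1) → Subfield (S.obj (Fin.last r)).functionField),
      IsCompleteDecomposition (S.partialComp (Fin.last r)) M ↔
        ∃ h : s = r, ∀ i : Fin (s + 1),
          M i = (functionFieldMap (S.map (Fin.le_last (i.cast (by rw [h]))))).fieldRange := by
  have has' := fun i => S.isNonabelianAlmostSimple_fiberGroup_res (has i)
  have hprim := fun i => S.stabilizer_covBy_res (hind i)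
  have hN : ∀ i : Fin r, ∃ σ : S.GaloisGroup, (∀ y : S.Points i.castSucc, σ • y = y) ∧
      ∃ x : S.Points i.succ, σ • x ≠ x := by
    intro i
    -- `hgal` compares only `g_1, …, g_r`, not the identity of `X_0`. So for the first step the
    -- moving element comes from the strict inclusion of stabilizers, and for later steps from
    -- `hgal` at two consecutive indices.
    by_cases hi : i.1 = 0
    · have h0 : i.castSucc = 0 := Fin.ext hi
      have : Subsingleton (S.Points i.castSucc) := h0 ▸ inferInstance
      by_contra! hcon
      obtain ⟨x⟩ := S.nonempty_points i.succ
      have hlt := (hprim i x).lt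
      refine hlt.not_ge fun σ _ => hcon σ (fun y => Subsingleton.elim _ _) x
    · have h1 : i.1 - 1 < r := by omega
      have h2 : i.castSucc = (⟨i.1 - 1, h1⟩ : Fin r).succ := Fin.ext (by simp; omega)
      refine S.exists_moving_of_mapGaloisClosure_ne i.castSucc_le_succ ?_
      rw [h2]
      intro h
      have := congrArg Fin.val (hgal h)
      simp only at this
      omega
  have hK : ∀ (z : Fin (r + 1)) (i : Fin r) (h : z ⋖ i.castSucc), _ := fun z i h =>
    S.exists_of_not_hasDiagonalKernel h.le i.castSucc_le_succ (hdiag z i.castSucc i.succ h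
      ⟨i.castSucc_lt_succ, fun c h1 h2 => by
        simp only [Fin.lt_def, Fin.val_castSucc, Fin.val_succ] at h1 h2
        omega⟩)
  constructor
  · have h := (tower_factorsContain S.Points S.res S.res_refl S.res_res has' hN hK hprim
      (fun i => S.res_surjective _) S.nonempty_points (fun i => MapFiber (S.step i))
      (fun i => socMon (S.step i)) S.nonempty_mapFiber_equiv S.nonempty_socMon_equiv r le_rfl).2
    obtain ⟨e⟩ := S.nonempty_range_equiv_monodromyGroup (Fin.last r)
    exact (h.of_mulEquiv e (.refl _)).containsCompositionFactors
  · intro s M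
    exact covBy_chain_iff S.imageField (S.imageField_strictMono hind) S.imageField_last
      (S.exists_eq_imageField
        (tower_stabilizers S.Points S.res S.res_refl S.res_res has' hN hK hprim (Fin.last r))) s M
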